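/- Let $r$ be a positive integer, let $\mathbb{Z}_r=\{0,1,\dots,r-1\}$ with addition modulo $r$, and let $\mathfrak{S}_{n,r}$ be the group (under composition) of all permutations $w$ of the set of colored integers $\{a^c : 1\le a\le n,\ c\in\mathbb{Z}_r\}$ such that $w(a^0)=b^j$ implies $w(a^i)=b^{i+j}$ for all $i \in \mathbb{Z}_r$. Write $w=w(1)^{c_1}\cdots w(n)^{c_n}$ where $w(k^0)=w(k)^{c_k}$, and let $\overline{w}$ be the colored permutation with the same underlying permutation $w(1)\cdots w(n)$ and color vector $(-c_1,\dots,-c_n)$. Let $\mathcal{I}_n^{\mathrm{abs}}=\{w\in\mathfrak{S}_{n,r} : \overline{w}^{-1}=w\}$ be the set of absolute involutions and let $\mathrm{fix}^j(w)$ be the number of $k$ with $w(k)=k$ and $c_k=j$. An index $1\le k\le n-1$ is a descent of $w$ if $c_k<c_{k+1}$, or $c_k=c_{k+1}$ and $w(k)>w(k+1)$ (that is, $w(k)^{c_k}>w(k+1)^{c_{k+1}}$ in the color order $1^{r-1}<\cdots<n^{r-1}<\cdots<1^0<\cdots<n^0$). Let $x_i^{(c)}$ ($i\ge1$, $0\le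 c\le r-1$), $p_0,\dots,p_{r-1}$ and $z$ be commuting indeterminates, and write $\mathbf{x}^{(c)}=(x_1^{(c)},x_2^{(c)},\dots)$ and $\mathbf{X}^{(r)}=(\mathbf{x}^{(0)},\dots,\mathbf{x}^{(r-1)})$. For $w\in\mathfrak{S}_{n,r}$ let $$F_w(\mathbf{X}^{(r)})=\sum x_{i_1}^{(c_1)}x_{i_2}^{(c_2)}\cdots x_{i_n}^{(c_n)},$$ the sum being over all integers $i_1\ge i_2\ge\cdots\ge i_n\ge1$ such that $i_k>i_{k+1}$ for every descent $k$ of $w$, and let $$F(\mathcal{I}_n^{\mathrm{abs}};\mathbf{X}^{(r)},p_0,\dots,p_{r-1})=\sum_{w\in\mathcal{I}_n^{\mathrm{abs}}}F_w(\mathbf{X}^{(r)})\,p_0^{\mathrm{fix}^0(w)}\cdots p_{r-1}^{\mathrm{fix}^{r-1}(w)},$$ which is $1$ for $n=0$. Then, as formal power series, $$\sum_{n\ge0}F(\mathcal{I}_n^{\mathrm{abs}};\mathbf{X}^{(r)},p_0,\dots,p_{r-1})\,z^n=\prod_{c=0}^{r-1}\ \prod_{i\ge1}\bigl(1-zp_cx_i^{(c)}\bigr)^{-1}\prod_{1\le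 i<j}\bigl(1-z^2x_i^{(c)}x_j^{(c)}\bigr)^{-1}.$$ In particular, for every integer $n\ge0$, $$F(\mathcal{I}_n^{\mathrm{abs}};\mathbf{X}^{(r)},p_0,\dots,p_{r-1})=\sum_{\boldsymbol\lambda}\ \prod_{j=0}^{r-1}s_{\lambda^{(j)}}(\mathbf{x}^{(j)})\,p_j^{\mathrm{c}(\lambda^{(j)})},$$ where the sum is over all $r$-tuples $\boldsymbol\lambda=(\lambda^{(0)},\dots,\lambda^{(r-1)})$ of (possibly empty) integer partitions of total size $n$, $s_\lambda$ is the Schur function, and $\mathrm{c}(\lambda)$ is the number of columns of odd length of the Young diagram of $\lambda$. -/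

import Mathlib

open scoped MvPowerSeries.WithPiTopology PowerSeries.WithPiTopology

noncomputable section

namespace ColoredQSym

/-! Colors are the elements of `Fin r` (the integers `0, …, r-1` with addition modulo `r`), and
letters and positions are the elements of `Fin n` (so `1, …, n` is shifted to `0, …, n-1`). The
colored integer `a^c` is the pair `(a, c)`. -/

/-- The `r`-colored permutation group: all permutations `w` of the set of colored integers such
that `w(a^0) = b^j` implies `w(a^i) = b^(i+j)`; the product is composition. -/
def coloredPerm (n r : ℕ) [NeZero r] : Subgroup (Equiv.Perm (Fin n × Fin r)) where
  carrier := {w | ∀ (a b : Fin n) (i j : Fin r), w (a, 0) = (b, j) → w (a, i) = (b, i + j)}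
  one_mem' := by
    intro a b i j h
    simp only [Equiv.Perm.coe_one, id_eq, Prod.mk.injEq] at h ⊢
    exact ⟨h.1, by rw [← h.2, add_zero]⟩
  mul_mem' := by
    intro u v hu hv a b i j h
    rw [Equiv.Perm.mul_apply] at h ⊢
    have h1 := hv a (v (a, 0)).1 i (v (a, 0)).2 rfl
    have h2 := hu (v (a, 0)).1 (u ((v (a, 0)).1, 0)).1 (v (a, 0)).2
      (u ((v (a, 0)).1, 0)).2 rfl
    have h3 := hu (v (a, 0)).1 (u ((v (a, 0)).1, 0)).1 (i + (v (a, 0)).2)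
      (u ((v (a, 0)).1, 0)).2 rfl
    rw [Prod.mk.eta, h, Prod.mk.injEq] at h2
    rw [h1, h3, ← h2.1, h2.2, add_assoc]
  inv_mem' := by
    intro w hw a b i j h
    rw [Equiv.Perm.inv_eq_iff_eq] at h ⊢
    have h1 := hw b (w (b, 0)).1 j (w (b, 0)).2 rfl
    have h2 := hw b (w (b, 0)).1 (i + j) (w (b, 0)).2 rfl
    rw [← h, Prod.mk.injEq] at h1
    rw [h2, ← h1.1, add_assoc, ← h1.2, add_zero]

variable {n r : ℕ} [NeZero r]

/-- The `k`-th entry `w(k)^{c_k}` of the window notation of `w`: its first component is the value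
of the underlying permutation at `k`, its second component is the color `c_k`. -/
def window (w : coloredPerm n r) (k : Fin n) : Fin n × Fin r :=
  (w : Equiv.Perm (Fin n × Fin r)) (k, 0)

/-- The permutation `a^c ↦ a^(-c)` of the colored integers. -/
def negColor (n r : ℕ) [NeZero r] : Equiv.Perm (Fin n × Fin r) :=
  Equiv.prodCongr (Equiv.refl (Fin n)) (Equiv.neg (Fin r))

/-- The colored permutation with the same underlying permutation as `w` and the negated color
vector; see `window_bar`. -/
def bar (w : coloredPerm n r) : coloredPerm n r where
  val := negColor n r * (w : Equiv.Perm (Fin n × Fin r)) * negColor n r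
  property := by
    intro a b i j h
    have hw := w.2
    simp only [negColor, Equiv.Perm.mul_apply, Equiv.prodCongr_apply, Prod.map_apply,
      Equiv.refl_apply, Equiv.neg_apply, neg_zero] at h ⊢
    have h1 := hw a ((w : Equiv.Perm (Fin n × Fin r)) (a, 0)).1 (-i)
      ((w : Equiv.Perm (Fin n × Fin r)) (a, 0)).2 rfl
    rw [h1]
    simp only [Prod.map, Equiv.refl_apply, Prod.mk.injEq] at h ⊢
    exact ⟨h.1, by rw [← h.2, neg_add, neg_neg]⟩

theorem window_bar (w : coloredPerm n r) (k : Fin n) :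
    window (bar w) k = ((window w k).1, -(window w k).2) := by
  simp [window, bar, negColor, Equiv.Perm.mul_apply, Prod.map]

/-- The absolute involutions: the colored permutations `w` whose `bar` has inverse `w`. -/
def absInvolutions (n r : ℕ) [NeZero r] : Finset (coloredPerm n r) :=
  (Set.toFinite {w : coloredPerm n r | (bar w)⁻¹ = w}).toFinset

/-- The color order `1^{r-1} < ⋯ < n^{r-1} < ⋯ < 1^0 < ⋯ < n^0` on colored integers. -/
def colorLT (u v : Fin n × Fin r) : Prop :=
  v.2 < u.2 ∨ (u.2 = v.2 ∧ u.1 < v.1)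

/-- `k` is a (type A) descent of `w` with respect to the color order, where the position `k` and
its successor are both in range. -/
def IsDescent (w : coloredPerm n r) (k : ℕ) : Prop :=
  ∃ h : k + 1 < n, colorLT (window w ⟨k + 1, h⟩) (window w ⟨k, Nat.lt_of_succ_lt h⟩)

/-- The number of fixed points of `w` of color `c`. -/
def fixCount (w : coloredPerm n r) (c : Fin r) : ℕ :=
  (Finset.univ.filter fun k : Fin n => window w k = (k, c)).card

/-- The index sequences `i_1 ≥ ⋯ ≥ i_n` with `i_k > i_{k+1}` at every descent `k` of `w`. The
indices of the indeterminates run over `0, 1, 2, …` instead of `1, 2, 3, …`. -/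
def fundamentalIndices (w : coloredPerm n r) : Set (Fin n → ℕ) :=
  {s | Antitone s ∧ ∀ (k : ℕ) (h : k + 1 < n), IsDescent w k →
    s ⟨k + 1, h⟩ < s ⟨k, Nat.lt_of_succ_lt h⟩}

/-- The fundamental colored quasisymmetric function of `w`: the formal power series
`∑ x_{i_1}^{(c_1)} ⋯ x_{i_n}^{(c_n)}` over the sequences in `fundamentalIndices w`, given by its
coefficients. The indeterminate `x_i^{(c)}` is indexed by the pair `(c, i)`. -/
def fundamental (R : Type*) [CommRing R] (w : coloredPerm n r) :
    MvPowerSeries (Fin r × ℕ) R :=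
  fun m => (Set.ncard {s : Fin n → ℕ | s ∈ fundamentalIndices w ∧
    ∑ k, Finsupp.single ((window w k).2, s k) 1 = m} : R)

/-- The quasisymmetric generating function of the absolute involutions, by the numbers of fixed
points of the various colors. -/
def absInvolutionSeries {R : Type*} [CommRing R] (n : ℕ) (p : Fin r → R) :
    MvPowerSeries (Fin r × ℕ) R :=
  ∑ w ∈ absInvolutions n r, (∏ c, p c ^ fixCount w c) • fundamental R w

/-- The Schur function `s_μ(x^{(c)})` in the indeterminates of color `c`: the sum over all
semistandard Young tableaux `T` of shape `μ` of the product of `x_{T(u)}^{(c)}` over the cells `u`,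
given by its coefficients. -/
def schur (R : Type*) [CommRing R] (c : Fin r) (μ : YoungDiagram) :
    MvPowerSeries (Fin r × ℕ) R :=
  fun m => (Set.ncard {T : SemistandardYoungTableau μ |
    ∑ u ∈ μ.cells, Finsupp.single (c, T u.1 u.2) 1 = m} : R)

/-- The number of columns of odd length. -/
def oddColumns (μ : YoungDiagram) : ℕ :=
  ((Finset.range (μ.rowLen 0)).filter fun j => Odd (μ.colLen j)).card

theorem finite_card_le (n : ℕ) : {μ : YoungDiagram | μ.card ≤ n}.Finite := by
  have key : ∀ μ : YoungDiagram, μ.card ≤ n →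
      μ.cells ⊆ Finset.range n ×ˢ Finset.range n := by
    intro μ hμ x hx
    have hx' : (x.1, x.2) ∈ μ := hx
    have h1 : (Finset.range (x.1 + 1)).image (fun i => (i, x.2)) ⊆ μ.cells := by
      intro y hy
      obtain ⟨i, hi, rfl⟩ := Finset.mem_image.1 hy
      exact μ.up_left_mem (Nat.lt_succ_iff.1 (Finset.mem_range.1 hi)) le_rfl hx'
    have h2 : (Finset.range (x.2 + 1)).image (fun j => (x.1, j)) ⊆ μ.cells := by
      intro y hy
      obtain ⟨j, hj, rfl⟩ := Finset.mem_image.1 hy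
      exact μ.up_left_mem le_rfl (Nat.lt_succ_iff.1 (Finset.mem_range.1 hj)) hx'
    have c1 := Finset.card_le_card h1
    have c2 := Finset.card_le_card h2
    rw [Finset.card_image_of_injective _ (fun a b h => by simpa using h),
      Finset.card_range] at c1 c2
    have hc : μ.cells.card ≤ n := hμ
    simp only [Finset.mem_product, Finset.mem_range]
    omega
  refine Set.Finite.of_finite_image (f := YoungDiagram.cells)
    ((Finset.finite_toSet (Finset.range n ×ˢ Finset.range n).powerset).subset ?_) ?_
  · rintro _ ⟨μ, hμ, rfl⟩
    exact Finset.mem_coe.2 (Finset.mem_powerset.2 (key μ hμ))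
  · intro μ _ ν _ h
    exact YoungDiagram.ext h

theorem finite_rPartite (r n : ℕ) :
    {l : Fin r → YoungDiagram | ∑ j, (l j).card = n}.Finite := by
  refine (Set.Finite.pi' (fun _ : Fin r => finite_card_le n)).subset ?_
  intro l hl j
  have hl' : ∑ j, (l j).card = n := hl
  exact hl' ▸ Finset.single_le_sum (f := fun j => (l j).card) (fun _ _ => Nat.zero_le _)
    (Finset.mem_univ j)

/-- The `r`-partite partitions of `n`: the `r`-tuples of partitions (given by their Young
diagrams) of total size `n`. -/
def rPartitePartitions (r n : ℕ) : Finset (Fin r → YoungDiagram) :=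
  (finite_rPartite r n).toFinset

/-- The factor `(1 - z p_c x_i^{(c)})⁻¹`, as a power series in `z` over the power series in the
indeterminates `x_i^{(c)}`; `Ring.inverse` is the inverse in this ring. -/
def fixFactor {R : Type*} [CommRing R] (p : Fin r → R) (c : Fin r) (i : ℕ) :
    PowerSeries (MvPowerSeries (Fin r × ℕ) R) :=
  Ring.inverse (1 - PowerSeries.X * PowerSeries.C (p c • MvPowerSeries.X (c, i)))

/-- The factor `(1 - z² x_i^{(c)} x_j^{(c)})⁻¹`. -/
def pairFactor (R : Type*) [CommRing R] (c : Fin r) (i j : ℕ) :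
    PowerSeries (MvPowerSeries (Fin r × ℕ) R) :=
  Ring.inverse (1 - PowerSeries.X ^ 2 *
    PowerSeries.C (MvPowerSeries.X (c, i) * MvPowerSeries.X (c, j)))

end ColoredQSym

end

/-! Every series in the theorem enumerates the same objects: families of finitely supported
symmetric matrices over the natural numbers, one matrix for each color `c`, where the `i`-th row sum
is the exponent of `x_i^{(c)}` and the trace is the exponent of `p_c`.

For the product this is the expansion into geometric series: the factor of `x_i` records the
diagonal entry `(i, i)`, the factor of `x_i x_j` the common value of the entries `(i, j)` and `(j,
i)` (`hasProd_inverse_one_sub`).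

For the involutions it is standardization. An absolute involution is an ordinary involution of the
positions with colors constant on its cycles (`mem_absInvolutions`). Label each position by its
index and color; the sequence is compatible with the descents exactly when the labels increase
weakly and the permutation increases on equal labels (`mem_fundamentalIndices_iff`). Such data
amount to the sorted list of the pairs (label of `k`, label of `w(k)`), that is, to a symmetric
matrix with no entries between different colors. Two distinct positions of a cycle cannot share a
label, so the diagonal counts the fixed points (`bijOn_involutionMatrix`).

For the Schur functions it is the symmetric RSK correspondence. A semistandard tableau is a chain of
partitions growing by horizontal strips, and symmetric growth diagrams match these chains with
symmetric matrices, row by row (`exists_bijOn_gtPatterns_triangular`). The content becomes the row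
sums. Adding a row raises the alternating sum of the parts of the shape by the new diagonal entry;
as that sum is the number of odd columns (`altSum_rowLen`), this number is the trace. The outcome is
Littlewood's identity for each color (`mk_sum_schur`). -/

noncomputable section

namespace ColoredQSym

/-! ### Infinite products of geometric series in monomials -/

section MonomialProducts

variable {ι σ R : Type*} [CommRing R]

/-- The exponent of the product of the monomials `x ^ e i`, each taken `A i` times. -/
def totalExponent (e : ι → σ →₀ ℕ) (A : ι →₀ ℕ) : σ →₀ ℕ :=
  Finsupp.linearCombination ℕ e A

/-- The product of the scalars `a i`, each taken `A i` times. -/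
def scalarWeight (a : ι → R) (A : ι →₀ ℕ) : R :=
  A.prod fun i k => a i ^ k

theorem totalExponent_add (e : ι → σ →₀ ℕ) (A B : ι →₀ ℕ) :
    totalExponent e (A + B) = totalExponent e A + totalExponent e B :=
  map_add _ _ _

theorem totalExponent_single (e : ι → σ →₀ ℕ) (i : ι) (k : ℕ) :
    totalExponent e (Finsupp.single i k) = k • e i :=
  Finsupp.linearCombination_single ..

theorem scalarWeight_add_single (a : ι → R) (A : ι →₀ ℕ) (i : ι) :
    scalarWeight a (A + Finsupp.single i 1) = scalarWeight a A * a i := by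
  classical
  rw [scalarWeight, Finsupp.prod_add_index' (by simp) (by simp [pow_add]),
    Finsupp.prod_single_index (by simp), pow_one, scalarWeight]

theorem smul_le_totalExponent (e : ι → σ →₀ ℕ) (A : ι →₀ ℕ) (i : ι) :
    A i • e i ≤ totalExponent e A := by
  classical
  by_cases hi : i ∈ A.support
  · rw [totalExponent, Finsupp.linearCombination_apply, Finsupp.sum]
    exact Finset.single_le_sum (f := fun i => A i • e i) (fun _ _ => zero_le) hi
  · rw [Finsupp.notMem_support_iff.1 hi, zero_smul]
    exact zero_le

theorem le_totalExponent (e : ι → σ →₀ ℕ) {A : ι →₀ ℕ} {i : ι} (hi : i ∈ A.support) :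
    e i ≤ totalExponent e A := by
  refine le_trans ?_ (smul_le_totalExponent e A i)
  have h : 1 ≤ A i := Nat.one_le_iff_ne_zero.2 (Finsupp.mem_support_iff.1 hi)
  calc e i = 1 • e i := (one_smul _ _).symm
    _ ≤ A i • e i := nsmul_le_nsmul_left (zero_le) h

/-- A family of nontrivial monomials, finitely many of which divide a given one. -/
structure LocallyFiniteMonomials (e : ι → σ →₀ ℕ) : Prop where
  ne_zero : ∀ i, e i ≠ 0
  finite_le : ∀ m, {i | e i ≤ m}.Finite

/-- Only the monomials dividing `x ^ m` can occur, and since each has positive degree its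
multiplicity is at most the degree of `m`. This finiteness makes the sums `∑ᶠ` in
`multiplicitySeries` genuine. -/
theorem LocallyFiniteMonomials.finite_totalExponent {e : ι → σ →₀ ℕ}
    (he : LocallyFiniteMonomials e) (m : σ →₀ ℕ) : {A | totalExponent e A = m}.Finite := by
  classical
  refine (Finset.finite_toSet ((he.finite_le m).toFinset.finsupp
    fun _ => Finset.range (m.degree + 1))).subset ?_
  rintro A rfl
  rw [Finset.mem_coe, Finset.mem_finsupp_iff]
  refine ⟨?_, fun i _ => ?_⟩
  · intro i hi
    simpa using le_totalExponent e hi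
  · by_cases hi : i ∈ A.support
    · rw [Finset.mem_range, Nat.lt_succ_iff]
      have h := Finsupp.degree_mono (smul_le_totalExponent e A i)
      rw [map_nsmul, smul_eq_mul] at h
      have h1 : (e i).degree ≠ 0 := fun h0 => he.ne_zero i ((Finsupp.degree_eq_zero_iff _).1 h0)
      exact le_trans (Nat.le_mul_of_pos_right _ (Nat.pos_of_ne_zero h1)) h
    · rw [Finsupp.notMem_support_iff.1 hi]
      simp

/-- The multiplicity functions supported in `T` with a prescribed total exponent. -/
def multiplicities (e : ι → σ →₀ ℕ) (T : Set ι) (m : σ →₀ ℕ) : Set (ι →₀ ℕ) :=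
  {A | (A.support : Set ι) ⊆ T ∧ totalExponent e A = m}

theorem LocallyFiniteMonomials.finite_multiplicities {e : ι → σ →₀ ℕ}
    (he : LocallyFiniteMonomials e) (T : Set ι) (m : σ →₀ ℕ) : (multiplicities e T m).Finite :=
  (he.finite_totalExponent m).subset fun _ h => h.2

/-- The generating function of the multiplicity functions supported in `T`. -/
def multiplicitySeries (e : ι → σ →₀ ℕ) (a : ι → R) (T : Set ι) :
    PowerSeries (MvPowerSeries σ R) :=
  PowerSeries.mk fun n => show MvPowerSeries σ R from fun m =>
    if m.degree = n then ∑ᶠ A ∈ multiplicities e T m, scalarWeight a A else 0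

theorem coeff_multiplicitySeries (e : ι → σ →₀ ℕ) (a : ι → R) (T : Set ι) (n : ℕ) (m : σ →₀ ℕ) :
    MvPowerSeries.coeff m (PowerSeries.coeff n (multiplicitySeries e a T)) =
      if m.degree = n then ∑ᶠ A ∈ multiplicities e T m, scalarWeight a A else 0 := by
  rw [multiplicitySeries, PowerSeries.coeff_mk]
  rfl

/-- The term `z ^ |e i| • a i • x ^ e i`. -/
def gradedTerm (e : ι → σ →₀ ℕ) (a : ι → R) (i : ι) : PowerSeries (MvPowerSeries σ R) :=
  PowerSeries.X ^ (e i).degree * PowerSeries.C (MvPowerSeries.monomial (e i) (a i))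

theorem coeff_mul_gradedTerm (e : ι → σ →₀ ℕ) (a : ι → R) (i : ι)
    (f : PowerSeries (MvPowerSeries σ R)) (n : ℕ) (m : σ →₀ ℕ) :
    MvPowerSeries.coeff m (PowerSeries.coeff n (f * gradedTerm e a i)) =
      if (e i).degree ≤ n ∧ e i ≤ m then
        MvPowerSeries.coeff (m - e i) (PowerSeries.coeff (n - (e i).degree) f) * a i else 0 := by
  rw [gradedTerm, mul_comm (PowerSeries.X ^ _), ← mul_assoc, PowerSeries.coeff_mul_X_pow']
  by_cases h1 : (e i).degree ≤ n
  · rw [if_pos h1, PowerSeries.coeff_mul_C, MvPowerSeries.coeff_mul_monomial]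
    simp [h1]
  · simp [h1]

/-- Either `i` is not used, or one copy of it can be removed. The second alternative is the one
cancelled by the factor `1 - gradedTerm e a i`, so no geometric series has to be written out. -/
theorem multiplicities_insert {e : ι → σ →₀ ℕ} {T : Set ι} {i : ι} {m : σ →₀ ℕ}
    (him : e i ≤ m) :
    multiplicities e (insert i T) m = multiplicities e T m ∪
      (fun A => A + Finsupp.single i 1) '' multiplicities e (insert i T) (m - e i) := by
  classical
  ext A
  constructor
  · rintro ⟨h1, h2⟩
    by_cases hi : i ∈ A.support
    · right
      have hle : Finsupp.single i 1 ≤ A := by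
        rw [Finsupp.single_le_iff]
        exact Nat.one_le_iff_ne_zero.2 (Finsupp.mem_support_iff.1 hi)
      have hA : A - Finsupp.single i 1 + Finsupp.single i 1 = A := tsub_add_cancel_of_le hle
      refine ⟨A - Finsupp.single i 1, ⟨?_, ?_⟩, hA⟩
      · exact (Finset.coe_subset.2 (Finsupp.support_mono tsub_le_self)).trans h1
      · rw [← h2, ← hA, totalExponent_add, totalExponent_single, one_smul, hA, add_tsub_cancel_right]
    · left
      refine ⟨fun j hj => ?_, h2⟩
      rcases h1 hj with rfl | h
      · exact absurd hj hi
      · exact h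
  · rintro (⟨h1, h2⟩ | ⟨A, ⟨h1, h2⟩, rfl⟩)
    · exact ⟨h1.trans (Set.subset_insert _ _), h2⟩
    · refine ⟨fun j hj => ?_, ?_⟩
      · by_cases hji : j = i
        · exact Or.inl hji
        · refine h1 ?_
          simpa [Finsupp.single_apply, Ne.symm hji] using hj
      · simp only [totalExponent_add, totalExponent_single, one_smul, h2]
        exact tsub_add_cancel_of_le him

theorem multiplicitySeries_insert_mul {e : ι → σ →₀ ℕ} (he : LocallyFiniteMonomials e) (a : ι → R)
    {T : Set ι} {i : ι} (hi : i ∉ T) :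
    multiplicitySeries e a (insert i T) * (1 - gradedTerm e a i) = multiplicitySeries e a T := by
  classical
  ext n m
  rw [mul_sub, mul_one, map_sub, map_sub, coeff_mul_gradedTerm, coeff_multiplicitySeries,
    coeff_multiplicitySeries, coeff_multiplicitySeries]
  by_cases him : e i ≤ m
  · have hdeg : m.degree = (m - e i).degree + (e i).degree := by
      rw [← map_add, tsub_add_cancel_of_le him]
    by_cases hn : m.degree = n
    · have h1 : (e i).degree ≤ n ∧ e i ≤ m := ⟨by omega, him⟩
      have h2 : (m - e i).degree = n - (e i).degree := by omega
      rw [if_pos hn, if_pos h1, if_pos h2, if_pos hn, multiplicities_insert him,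
        finsum_mem_union _ (he.finite_multiplicities _ _)
          ((he.finite_multiplicities _ _).image _), finsum_mem_image, finsum_mem_mul']
      · simp only [scalarWeight_add_single]
        ring
      · exact he.finite_multiplicities _ _
      · exact fun A _ B _ h => add_right_cancel h
      · rw [Set.disjoint_left]
        rintro _ ⟨h3, -⟩ ⟨A, -, rfl⟩
        exact hi (h3 (by simp))
    · by_cases h1 : (e i).degree ≤ n
      · have h2 : (m - e i).degree ≠ n - (e i).degree := by omega
        simp [hn, h2]
      · simp [hn, h1]
  · rw [if_neg (c := _ ∧ _) (fun h => him h.2), sub_zero]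
    have : multiplicities e (insert i T) m = multiplicities e T m := by
      ext A
      refine ⟨fun h => ⟨fun j hj => ?_, h.2⟩, fun h => ⟨h.1.trans (Set.subset_insert _ _), h.2⟩⟩
      rcases h.1 hj with rfl | h'
      · exact absurd (h.2 ▸ le_totalExponent e hj) him
      · exact h'
    rw [this]

theorem multiplicitySeries_empty (e : ι → σ →₀ ℕ) (a : ι → R) :
    multiplicitySeries e a ∅ = 1 := by
  classical
  have h0 : multiplicities e ∅ 0 = {0} := by
    ext A
    constructor
    · rintro ⟨h, -⟩
      simpa using h
    · rintro rfl
      exact ⟨by simp, map_zero _⟩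
  ext n m
  rw [coeff_multiplicitySeries, PowerSeries.coeff_one]
  by_cases hm : m = 0
  · subst hm
    rw [h0, finsum_mem_singleton]
    by_cases hn : n = 0
    · simp [hn, scalarWeight]
    · simp [hn, Ne.symm hn]
  · have h1 : multiplicities e ∅ m = ∅ := by
      ext A
      simp only [Set.mem_empty_iff_false, iff_false]
      rintro ⟨h, h2⟩
      have : A = 0 := by simpa using h
      subst this
      exact hm (h2.symm.trans (map_zero _))
    rw [h1, finsum_mem_empty, ite_self]
    split_ifs
    · rw [MvPowerSeries.coeff_one, if_neg hm]
    · simp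

theorem isUnit_one_sub_gradedTerm {e : ι → σ →₀ ℕ} (he : LocallyFiniteMonomials e) (a : ι → R)
    (i : ι) : IsUnit (1 - gradedTerm e a i) := by
  rw [PowerSeries.isUnit_iff_constantCoeff]
  have h1 : (e i).degree ≠ 0 := fun h0 => he.ne_zero i ((Finsupp.degree_eq_zero_iff _).1 h0)
  simp [gradedTerm, h1]

theorem prod_inverse_one_sub {e : ι → σ →₀ ℕ} (he : LocallyFiniteMonomials e) (a : ι → R)
    (T : Finset ι) :
    ∏ i ∈ T, Ring.inverse (1 - gradedTerm e a i) = multiplicitySeries e a T := by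
  classical
  induction T using Finset.induction_on with
  | empty => rw [Finset.prod_empty, Finset.coe_empty, multiplicitySeries_empty]
  | insert i T hi ih =>
    rw [Finset.prod_insert hi, ih, mul_comm, Finset.coe_insert,
      ← multiplicitySeries_insert_mul he a (Finset.mem_coe.not.2 hi), mul_assoc,
      Ring.mul_inverse_cancel _ (isUnit_one_sub_gradedTerm he a i), mul_one]

/-- A coefficient at `m` of a partial product is constant once the finite index set contains the
finitely many `i` with `e i ≤ m`. Eventual constancy gives convergence for any topology on `R`. -/
theorem hasProd_inverse_one_sub [TopologicalSpace R] {e : ι → σ →₀ ℕ}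
    (he : LocallyFiniteMonomials e) (a : ι → R) :
    HasProd (fun i => Ring.inverse (1 - gradedTerm e a i))
      (multiplicitySeries e a Set.univ) := by
  classical
  rw [HasProd, PowerSeries.WithPiTopology.tendsto_iff_coeff_tendsto]
  intro n
  rw [MvPowerSeries.WithPiTopology.tendsto_iff_coeff_tendsto]
  intro m
  refine Filter.Tendsto.congr' ?_ tendsto_const_nhds
  rw [SummationFilter.unconditional_filter]
  filter_upwards [Filter.eventually_ge_atTop (he.finite_le m).toFinset] with T hT
  rw [prod_inverse_one_sub he, coeff_multiplicitySeries, coeff_multiplicitySeries]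
  refine if_congr Iff.rfl (finsum_mem_congr ?_ fun _ _ => rfl) rfl
  ext A
  refine ⟨fun h => ⟨fun j hj => ?_, h.2⟩, fun h => ⟨Set.subset_univ _, h.2⟩⟩
  refine hT ?_
  rw [Set.Finite.mem_toFinset]
  exact h.2 ▸ le_totalExponent e hj

end MonomialProducts

/-! ### Symmetric growth diagrams and the symmetric RSK correspondence -/

section Growth

/-- `ν / μ` is a horizontal strip, for partitions given by their sequences of parts. -/
def Interlace (μ ν : ℕ → ℕ) : Prop :=
  ∀ i, ν (i + 1) ≤ μ i ∧ μ i ≤ ν i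

/-- The local rule of the growth diagrams for the row insertion of matrices: the outer corner of a
square with inner corner `μ`, sides `l`, `k` and entry `a`. -/
def growUp (l μ k : ℕ → ℕ) (a : ℕ) : ℕ → ℕ
  | 0 => max (l 0) (k 0) + a
  | i + 1 => max (l (i + 1)) (k (i + 1)) + (min (l i) (k i) - μ i)

/-- The inner corner of a square with outer corner `ν` and sides `l`, `k`. -/
def growDown (l k ν : ℕ → ℕ) (i : ℕ) : ℕ :=
  max (l (i + 1)) (k (i + 1)) + min (l i) (k i) - ν (i + 1)

theorem interlace_growUp_left {l μ k : ℕ → ℕ} (a : ℕ) (hl : Interlace μ l) (hk : Interlace μ k) :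
    Interlace l (growUp l μ k a) := by
  intro i
  have h1 := hl i
  have h2 := hk i
  refine ⟨by simp only [growUp]; omega, ?_⟩
  cases i <;> simp only [growUp] <;> omega

theorem interlace_growUp_right {l μ k : ℕ → ℕ} (a : ℕ) (hl : Interlace μ l) (hk : Interlace μ k) :
    Interlace k (growUp l μ k a) := by
  intro i
  have h1 := hl i
  have h2 := hk i
  refine ⟨by simp only [growUp]; omega, ?_⟩
  cases i <;> simp only [growUp] <;> omega

theorem interlace_growDown_left {l k ν : ℕ → ℕ} (hl : Interlace l ν) (hk : Interlace k ν) :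
    Interlace (growDown l k ν) l := by
  intro i
  have h1 := hl i
  have h2 := hk i
  have h3 := hl (i + 1)
  have h4 := hk (i + 1)
  simp only [growDown]
  omega

theorem interlace_growDown_right {l k ν : ℕ → ℕ} (hl : Interlace l ν) (hk : Interlace k ν) :
    Interlace (growDown l k ν) k := by
  intro i
  have h1 := hl i
  have h2 := hk i
  have h3 := hl (i + 1)
  have h4 := hk (i + 1)
  simp only [growDown]
  omega

/-- The two maxima cancel, leaving `min (l i) (k i) - (min (l i) (k i) - μ i)`. Interlacing gives `μ
i ≤ min (l i) (k i)`, so the truncated subtractions are exact. -/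
theorem growDown_growUp {l μ k : ℕ → ℕ} (a : ℕ) (hl : Interlace μ l) (hk : Interlace μ k) :
    growDown l k (growUp l μ k a) = μ := by
  funext i
  have h1 := hl i
  have h2 := hk i
  simp only [growDown, growUp]
  omega

theorem growUp_growDown {l k ν : ℕ → ℕ} (hl : Interlace l ν) (hk : Interlace k ν) :
    growUp l (growDown l k ν) k (ν 0 - max (l 0) (k 0)) = ν := by
  funext i
  cases i with
  | zero =>
    have h1 := hl 0
    have h2 := hk 0
    simp only [growUp]
    omega
  | succ i =>
    have h1 := hl i
    have h2 := hk i
    have h3 := hl (i + 1)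
    have h4 := hk (i + 1)
    simp only [growUp, growDown]
    omega

/-- Since a maximum and a minimum of two numbers add up to their sum, the local rule conserves size
up to the entry `a`. The boundary term disappears as soon as the parts at `M` vanish. -/
theorem sum_growUp {l μ k : ℕ → ℕ} (a : ℕ) (hl : Interlace μ l) (hk : Interlace μ k) (M : ℕ) :
    ∑ i ∈ Finset.range (M + 1), growUp l μ k a i + ∑ i ∈ Finset.range M, μ i =
      a + ∑ i ∈ Finset.range M, l i + ∑ i ∈ Finset.range M, k i + max (l M) (k M) := by
  induction M with
  | zero => simp [growUp]; omega
  | succ M ih =>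
    rw [Finset.sum_range_succ _ (M + 1), Finset.sum_range_succ μ, Finset.sum_range_succ l,
      Finset.sum_range_succ k]
    have h1 := hl M
    have h2 := hk M
    simp only [growUp] at ih ⊢
    omega

/-- The alternating sum of the first `M` parts. -/
def altSum (M : ℕ) (v : ℕ → ℕ) : ℤ :=
  ∑ i ∈ Finset.range M, (-1) ^ i * (v i : ℤ)

/-- On a diagonal square both sides equal `l`, so part `i + 1` of the outer corner is `l (i + 1) + l
i - μ i`. The contributions of `l` telescope in the alternating sum, and only `a`, `μ` and a
boundary term survive. -/
theorem altSum_growUp {l μ : ℕ → ℕ} (a : ℕ) (hl : Interlace μ l) (M : ℕ) :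
    altSum (M + 1) (growUp l μ l a) = a + altSum M μ + (-1) ^ M * (l M : ℤ) := by
  induction M with
  | zero => simp [altSum, growUp]; ring
  | succ M ih =>
    rw [altSum, Finset.sum_range_succ, ← altSum, ih, altSum, altSum, Finset.sum_range_succ _ M]
    have h1 := hl M
    simp only [growUp, max_self, min_self]
    push_cast [Nat.cast_sub h1.2]
    ring

/-- The Gelfand–Tsetlin patterns with `N` rows, as chains of partitions starting from the empty
one. -/
def gtPatterns (N : ℕ) : Set (ℕ → ℕ → ℕ) :=
  {L | L 0 = 0 ∧ (∀ k < N, Interlace (L k) (L (k + 1))) ∧ ∀ k, N < k → L k = 0}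

/-- The lower triangular matrices with `N` rows. -/
def triangular (N : ℕ) : Set (ℕ → ℕ → ℕ) :=
  {B | ∀ j i, ¬ (i ≤ j ∧ j < N) → B j i = 0}

theorem gtPatterns_apply_eq_zero {N : ℕ} {L : ℕ → ℕ → ℕ} (hL : L ∈ gtPatterns N) {k i : ℕ}
    (hki : k ≤ i) : L k i = 0 := by
  induction k generalizing i with
  | zero => rw [hL.1]; rfl
  | succ k ih =>
    by_cases hk : k < N
    · obtain ⟨i, rfl⟩ : ∃ j, i = j + 1 := ⟨i - 1, by omega⟩
      have := (hL.2.1 k hk i).1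
      rw [ih (by omega)] at this
      omega
    · rw [hL.2.2 _ (by omega)]; rfl

/-- The chain obtained from the chain `M` of length `N` by adding a row with entries `a` to the
symmetric growth diagram. -/
def growRow (N : ℕ) (M : ℕ → ℕ → ℕ) (a : ℕ → ℕ) : ℕ → ℕ → ℕ
  | 0 => 0
  | k + 1 =>
    if k < N then growUp (growRow N M a k) (M k) (M (k + 1)) (a k)
    -- The diagonal square: by symmetry the side above the diagonal is the mirror image of the side
    -- just computed.
    else if k = N then growUp (growRow N M a k) (M k) (growRow N M a k) (a k)
    else 0

/-- Auxiliary descending recursion for `shrinkRow`. -/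
def shrinkRowAux (N : ℕ) (L : ℕ → ℕ → ℕ) : ℕ → ℕ → ℕ
  -- The diagonal square comes first, because its two sides are known to coincide; step `t` then
  -- yields the partition with index `N - t`.
  | 0 => growDown (L N) (L N) (L (N + 1))
  | t + 1 => growDown (L (N - (t + 1))) (shrinkRowAux N L t) (L (N - t))

/-- The chain obtained from the chain `L` of length `N + 1` by removing a row from the symmetric
growth diagram. -/
def shrinkRow (N : ℕ) (L : ℕ → ℕ → ℕ) (k : ℕ) : ℕ → ℕ :=
  if k ≤ N then shrinkRowAux N L (N - k) else 0

/-- The entries of the row removed by `shrinkRow`. -/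
def shrinkVec (N : ℕ) (L : ℕ → ℕ → ℕ) (k : ℕ) : ℕ :=
  if k < N then L (k + 1) 0 - max (L k 0) (shrinkRow N L (k + 1) 0)
  else if k = N then L (k + 1) 0 - max (L k 0) (L k 0) else 0

theorem growRow_succ_of_lt {N k : ℕ} (h : k < N) (M : ℕ → ℕ → ℕ) (a : ℕ → ℕ) :
    growRow N M a (k + 1) = growUp (growRow N M a k) (M k) (M (k + 1)) (a k) := by
  rw [growRow, if_pos h]

theorem growRow_succ_self (N : ℕ) (M : ℕ → ℕ → ℕ) (a : ℕ → ℕ) :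
    growRow N M a (N + 1) = growUp (growRow N M a N) (M N) (growRow N M a N) (a N) := by
  rw [growRow, if_neg (lt_irrefl N), if_pos rfl]

theorem shrinkRow_self (N : ℕ) (L : ℕ → ℕ → ℕ) :
    shrinkRow N L N = growDown (L N) (L N) (L (N + 1)) := by
  rw [shrinkRow, if_pos le_rfl, Nat.sub_self, shrinkRowAux]

theorem shrinkRow_of_lt {N k : ℕ} (h : k < N) (L : ℕ → ℕ → ℕ) :
    shrinkRow N L k = growDown (L k) (shrinkRow N L (k + 1)) (L (k + 1)) := by
  obtain ⟨t, rfl⟩ : ∃ t, N = k + 1 + t := ⟨N - (k + 1), by omega⟩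
  rw [shrinkRow, shrinkRow, if_pos (by omega), if_pos (by omega),
    show k + 1 + t - k = t + 1 by omega, show k + 1 + t - (k + 1) = t by omega, shrinkRowAux,
    show k + 1 + t - (t + 1) = k by omega, show k + 1 + t - t = k + 1 by omega]

theorem interlace_growRow {N : ℕ} {M : ℕ → ℕ → ℕ} (hM : M ∈ gtPatterns N) (a : ℕ → ℕ) {k : ℕ}
    (hk : k ≤ N) : Interlace (M k) (growRow N M a k) := by
  induction k with
  | zero => rw [hM.1, growRow]; intro i; simp
  | succ k ih =>
    rw [growRow_succ_of_lt hk]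
    exact interlace_growUp_right _ (ih (by omega)) (hM.2.1 k hk)

theorem growRow_mem {N : ℕ} {M : ℕ → ℕ → ℕ} (hM : M ∈ gtPatterns N) (a : ℕ → ℕ) :
    growRow N M a ∈ gtPatterns (N + 1) := by
  refine ⟨by rw [growRow], fun k hk => ?_, fun k hk => ?_⟩
  · rcases Nat.lt_succ_iff_lt_or_eq.1 hk with h | rfl
    · rw [growRow_succ_of_lt h]
      exact interlace_growUp_left _ (interlace_growRow hM a h.le) (hM.2.1 k h)
    · rw [growRow_succ_self]
      exact interlace_growUp_left _ (interlace_growRow hM a le_rfl) (interlace_growRow hM a le_rfl)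
  · obtain ⟨k, rfl⟩ : ∃ j, k = j + 1 := ⟨k - 1, by omega⟩
    rw [growRow, if_neg (by omega), if_neg (by omega)]

theorem interlace_shrinkRow {N : ℕ} {L : ℕ → ℕ → ℕ} (hL : L ∈ gtPatterns (N + 1)) {k : ℕ}
    (hk : k ≤ N) : Interlace (shrinkRow N L k) (L k) := by
  induction hk using Nat.decreasingInduction with
  | self =>
    rw [shrinkRow_self]
    exact interlace_growDown_left (hL.2.1 N (by omega)) (hL.2.1 N (by omega))
  | of_succ k hk ih =>
    rw [shrinkRow_of_lt hk]
    exact interlace_growDown_left (hL.2.1 k (by omega)) ih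

theorem shrinkRow_mem {N : ℕ} {L : ℕ → ℕ → ℕ} (hL : L ∈ gtPatterns (N + 1)) :
    shrinkRow N L ∈ gtPatterns N := by
  refine ⟨?_, fun k hk => ?_, fun k hk => ?_⟩
  · funext i
    have h := (interlace_shrinkRow hL (Nat.zero_le N) i).2
    rw [hL.1] at h
    exact Nat.le_zero.1 h
  · rw [shrinkRow_of_lt hk]
    exact interlace_growDown_right (hL.2.1 k (by omega)) (interlace_shrinkRow hL hk)
  · rw [shrinkRow, if_neg (by omega)]

theorem shrinkRow_growRow {N : ℕ} {M : ℕ → ℕ → ℕ} (hM : M ∈ gtPatterns N) (a : ℕ → ℕ) :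
    shrinkRow N (growRow N M a) = M := by
  funext k
  by_cases hk : k ≤ N
  · induction hk using Nat.decreasingInduction with
    | self =>
      rw [shrinkRow_self, growRow_succ_self]
      exact growDown_growUp _ (interlace_growRow hM a le_rfl) (interlace_growRow hM a le_rfl)
    | of_succ k hk ih =>
      rw [shrinkRow_of_lt hk, ih, growRow_succ_of_lt hk]
      exact growDown_growUp _ (interlace_growRow hM a hk.le) (hM.2.1 k hk)
  · rw [shrinkRow, if_neg hk, hM.2.2 k (by omega)]

theorem shrinkVec_growRow {N : ℕ} {M : ℕ → ℕ → ℕ} (hM : M ∈ gtPatterns N) {a : ℕ → ℕ}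
    (ha : ∀ k, N < k → a k = 0) : shrinkVec N (growRow N M a) = a := by
  funext k
  rw [shrinkVec, shrinkRow_growRow hM]
  rcases lt_trichotomy k N with h | rfl | h
  · rw [if_pos h, growRow_succ_of_lt h, growUp]
    omega
  · rw [if_neg (lt_irrefl _), if_pos rfl, growRow_succ_self, growUp]
    omega
  · rw [if_neg (by omega), if_neg (by omega), ha k h]

theorem growRow_shrinkRow {N : ℕ} {L : ℕ → ℕ → ℕ} (hL : L ∈ gtPatterns (N + 1)) :
    growRow N (shrinkRow N L) (shrinkVec N L) = L := by
  funext k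
  by_cases hk : k ≤ N + 1
  · induction k with
    | zero => rw [growRow, hL.1]
    | succ k ih =>
      have ih' := ih (by omega)
      rcases Nat.lt_succ_iff_lt_or_eq.1 (show k < N + 1 by omega) with h | rfl
      · rw [growRow_succ_of_lt h, ih', shrinkVec, if_pos h, shrinkRow_of_lt h]
        exact growUp_growDown (hL.2.1 k (by omega)) (interlace_shrinkRow hL h)
      · rw [growRow_succ_self, ih', shrinkVec, if_neg (lt_irrefl _), if_pos rfl, shrinkRow_self]
        exact growUp_growDown (hL.2.1 k (by omega)) (hL.2.1 k (by omega))
  · rw [hL.2.2 k (by omega), (growRow_mem (shrinkRow_mem hL) _).2.2 k (by omega)]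

/-- The size of the `k`-th partition of a chain. -/
def chainSize (L : ℕ → ℕ → ℕ) (k : ℕ) : ℕ :=
  -- In a pattern the `k`-th partition has at most `k` parts, so nothing is cut off.
  ∑ i ∈ Finset.range k, L k i

theorem chainSize_growRow_succ {N : ℕ} {M : ℕ → ℕ → ℕ} (hM : M ∈ gtPatterns N) (a : ℕ → ℕ) {k : ℕ}
    (hk : k < N) :
    chainSize (growRow N M a) (k + 1) + chainSize M k =
      a k + chainSize (growRow N M a) k + chainSize M (k + 1) := by
  have h := sum_growUp (a k) (interlace_growRow hM a hk.le) (hM.2.1 k hk) k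
  rw [gtPatterns_apply_eq_zero (growRow_mem hM a) le_rfl, Nat.zero_max,
    ← growRow_succ_of_lt hk] at h
  simp only [chainSize, Finset.sum_range_succ (M (k + 1))]
  omega

theorem chainSize_growRow_self {N : ℕ} {M : ℕ → ℕ → ℕ} (hM : M ∈ gtPatterns N) (a : ℕ → ℕ) :
    chainSize (growRow N M a) (N + 1) + chainSize M N =
      a N + chainSize (growRow N M a) N + chainSize (growRow N M a) N := by
  have h := sum_growUp (a N) (interlace_growRow hM a le_rfl) (interlace_growRow hM a le_rfl) N
  rw [gtPatterns_apply_eq_zero (growRow_mem hM a) le_rfl, Nat.zero_max,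
    ← growRow_succ_self] at h
  simp only [chainSize]
  omega

theorem chainSize_growRow {N : ℕ} {M : ℕ → ℕ → ℕ} (hM : M ∈ gtPatterns N) (a : ℕ → ℕ) {k : ℕ}
    (hk : k ≤ N) :
    chainSize (growRow N M a) k = chainSize M k + ∑ j ∈ Finset.range k, a j := by
  induction k with
  | zero => simp [chainSize]
  | succ k ih =>
    have h1 := ih (by omega)
    have h2 := chainSize_growRow_succ hM a hk
    rw [Finset.sum_range_succ]
    omega

theorem altSum_growRow {N : ℕ} {M : ℕ → ℕ → ℕ} (hM : M ∈ gtPatterns N) (a : ℕ → ℕ) :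
    altSum (N + 1) (growRow N M a (N + 1)) = altSum N (M N) + a N := by
  rw [growRow_succ_self, altSum_growUp _ (interlace_growRow hM a le_rfl),
    gtPatterns_apply_eq_zero (growRow_mem hM a) le_rfl]
  push_cast
  ring

/-- The `k`-th row sum of the symmetric matrix with lower triangular part `B`. -/
def symRowSum (N : ℕ) (B : ℕ → ℕ → ℕ) (k : ℕ) : ℕ :=
  ∑ j ∈ Finset.range N, B (max j k) (min j k)

/-- The symmetric Robinson–Schensted–Knuth correspondence: Gelfand–Tsetlin patterns correspond to
symmetric matrices in such a way that the content is given by the row sums and the alternating sum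
of the parts of the shape by the trace. -/
theorem exists_bijOn_gtPatterns_triangular (N : ℕ) :
    ∃ f : (ℕ → ℕ → ℕ) → ℕ → ℕ → ℕ, Set.BijOn f (gtPatterns N) (triangular N) ∧
      ∀ L ∈ gtPatterns N,
        (∀ k < N, chainSize L (k + 1) = chainSize L k + symRowSum N (f L) k) ∧
        altSum N (L N) = ∑ k ∈ Finset.range N, (f L k k : ℤ) := by
  induction N with
  | zero =>
    refine ⟨fun _ => 0, ⟨fun L _ j i _ => rfl, ?_, ?_⟩, ?_⟩
    · have key : ∀ L ∈ gtPatterns 0, L = 0 := fun L hL => by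
        funext k
        rcases Nat.eq_zero_or_pos k with rfl | h
        · exact hL.1
        · exact hL.2.2 k h
      intro L hL L' hL' _
      rw [key L hL, key L' hL']
    · intro B hB
      refine ⟨0, ⟨rfl, by simp, by simp⟩, ?_⟩
      funext j i
      exact (hB j i (by omega)).symm
    · intro L hL
      simp [altSum]
  | succ N ih =>
    obtain ⟨f, hf, hprop⟩ := ih
    have hlt : ∀ L ∈ gtPatterns N, f L N = 0 := fun L hL => by
      funext i
      exact hf.mapsTo hL N i (by omega)
    have hvec : ∀ L k, N < k → shrinkVec N L k = 0 := fun L k hk => by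
      rw [shrinkVec, if_neg (by omega), if_neg (by omega)]
    -- The last row of the matrix is read off while the chain is shrunk, and the earlier rows come
    -- from the shrunken chain by induction.
    refine ⟨fun L => Function.update (f (shrinkRow N L)) N (shrinkVec N L), ⟨?_, ?_, ?_⟩, ?_⟩
    · intro L hL j i hji
      beta_reduce
      by_cases hj : j = N
      · subst hj
        rw [Function.update_self]
        exact hvec L i (by omega)
      · rw [Function.update_of_ne hj]
        exact hf.mapsTo (shrinkRow_mem hL) j i (by omega)
    · intro L hL L' hL' h
      have h1 : shrinkVec N L = shrinkVec N L' := by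
        simpa using congrFun h N
      have h2 : f (shrinkRow N L) = f (shrinkRow N L') := by
        funext j
        by_cases hj : j = N
        · rw [hj, hlt _ (shrinkRow_mem hL), hlt _ (shrinkRow_mem hL')]
        · simpa [hj] using congrFun h j
      rw [← growRow_shrinkRow hL, ← growRow_shrinkRow hL', h1,
        hf.injOn (shrinkRow_mem hL) (shrinkRow_mem hL') h2]
    · intro B hB
      have hB' : Function.update B N 0 ∈ triangular N := by
        intro j i hji
        by_cases hj : j = N
        · simp [hj]
        · rw [Function.update_of_ne hj]
          exact hB j i (by omega)
      obtain ⟨M, hM, hMB⟩ := hf.surjOn hB'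
      refine ⟨growRow N M (B N), growRow_mem hM _, ?_⟩
      simp only [shrinkRow_growRow hM, shrinkVec_growRow hM (fun k hk => hB N k (by omega)), hMB]
      simp
    · intro L hL
      obtain ⟨M, a, hM, ha, rfl⟩ : ∃ M a, M ∈ gtPatterns N ∧ (∀ k, N < k → a k = 0) ∧
          growRow N M a = L :=
        ⟨_, _, shrinkRow_mem hL, hvec L, growRow_shrinkRow hL⟩
      obtain ⟨h1, h2⟩ := hprop M hM
      simp only [shrinkRow_growRow hM, shrinkVec_growRow hM ha]
      constructor
      · intro k hk
        rw [symRowSum, Finset.sum_range_succ]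
        rcases Nat.lt_succ_iff_lt_or_eq.1 hk with h | rfl
        · have e1 : ∑ j ∈ Finset.range N, Function.update (f M) N a (max j k) (min j k) =
              symRowSum N (f M) k := by
            refine Finset.sum_congr rfl fun j hj => ?_
            rw [Function.update_of_ne]
            have := Finset.mem_range.1 hj
            omega
          rw [e1, max_eq_left h.le, min_eq_right h.le, Function.update_self]
          have := h1 k h
          have := chainSize_growRow_succ hM a h
          omega
        -- In the last row all the entries are new. Their sum off the diagonal is the growth of the
        -- partition of index `k` over the old shape, and the diagonal square adds that growth again
        -- together with its entry.
        · have e1 : ∑ j ∈ Finset.range k, Function.update (f M) k a (max j k) (min j k) =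
              ∑ j ∈ Finset.range k, a j := by
            refine Finset.sum_congr rfl fun j hj => ?_
            have := Finset.mem_range.1 hj
            rw [max_eq_right (by omega), min_eq_left (by omega), Function.update_self]
          rw [e1, max_self, min_self, Function.update_self]
          have := chainSize_growRow_self hM a
          have := chainSize_growRow hM a le_rfl
          omega
      · rw [altSum_growRow hM, h2, Finset.sum_range_succ, Function.update_self]
        congr 1
        refine Finset.sum_congr rfl fun j hj => ?_
        rw [Function.update_of_ne]
        have := Finset.mem_range.1 hj
        omega

end Growth

/-! ### Semistandard tableaux as Gelfand–Tsetlin patterns; odd columns -/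

section Tableaux

variable {r : ℕ}

/-- A finite lower set of natural numbers is an initial segment. This turns the cardinalities
defining `tableauChain` and `chainEntry` into inequalities. -/
theorem mem_iff_lt_card_of_lower {S : Finset ℕ} (hS : ∀ i j, i ≤ j → j ∈ S → i ∈ S) (j : ℕ) :
    j ∈ S ↔ j < S.card := by
  constructor
  · intro hj
    have h : Finset.range (j + 1) ⊆ S := fun i hi =>
      hS i j (Nat.lt_succ_iff.1 (Finset.mem_range.1 hi)) hj
    have := Finset.card_le_card h
    rw [Finset.card_range] at this
    omega
  · intro hj
    by_contra hjS
    have h : S ⊆ Finset.range j := fun i hi => by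
      rw [Finset.mem_range]
      by_contra hij
      exact hjS (hS j i (by omega) hi)
    have := Finset.card_le_card h
    rw [Finset.card_range] at this
    omega

theorem le_entry {μ : YoungDiagram} (T : SemistandardYoungTableau μ) {i j : ℕ}
    (h : (i, j) ∈ μ) : i ≤ T i j := by
  induction i with
  | zero => exact Nat.zero_le _
  | succ i ih =>
    have h1 := ih (μ.up_left_mem (Nat.le_succ i) le_rfl h)
    have h2 := T.col_strict (lt_add_one i) h
    omega

/-- The chain of the shapes of the subtableaux with entries `< k`, for `k ≤ N`. -/
def tableauChain (N : ℕ) {μ : YoungDiagram} (T : SemistandardYoungTableau μ) (k i : ℕ) : ℕ :=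
  if k ≤ N then ((Finset.range (μ.rowLen i)).filter fun j => T i j < k).card else 0

theorem lt_tableauChain_iff {N : ℕ} {μ : YoungDiagram} (T : SemistandardYoungTableau μ)
    {k i j : ℕ} (hk : k ≤ N) : j < tableauChain N T k i ↔ j < μ.rowLen i ∧ T i j < k := by
  rw [tableauChain, if_pos hk, ← mem_iff_lt_card_of_lower, Finset.mem_filter, Finset.mem_range]
  intro j j' hjj' hj'
  rw [Finset.mem_filter, Finset.mem_range] at hj' ⊢
  exact ⟨by omega,
    (T.row_weak_of_le hjj' (YoungDiagram.mem_iff_lt_rowLen.2 hj'.1)).trans_lt hj'.2⟩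

/-- Strict columns are what makes consecutive shapes differ by a horizontal strip: an entry at most
`k` in row `i + 1` lies below an entry less than `k`. -/
theorem tableauChain_mem {N : ℕ} {μ : YoungDiagram} (T : SemistandardYoungTableau μ) :
    tableauChain N T ∈ gtPatterns N := by
  refine ⟨?_, fun k hk i => ⟨?_, ?_⟩, fun k hk => ?_⟩
  · funext i
    simp [tableauChain]
  · by_contra! h
    have h1 := (lt_tableauChain_iff T (show k + 1 ≤ N from hk)).1 h
    have h2 := T.col_strict (lt_add_one i) (YoungDiagram.mem_iff_lt_rowLen.2 h1.1)
    have h3 := μ.rowLen_anti i (i + 1) (Nat.le_succ i)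
    exact lt_irrefl _ ((lt_tableauChain_iff T hk.le).2 ⟨h1.1.trans_le h3, by omega⟩)
  · by_contra! h
    have h1 := (lt_tableauChain_iff T hk.le).1 h
    exact lt_irrefl _ ((lt_tableauChain_iff T (show k + 1 ≤ N from hk)).2 ⟨h1.1, by omega⟩)
  · funext i
    rw [tableauChain, if_neg (by omega)]
    rfl

theorem chainSize_tableauChain {N : ℕ} {μ : YoungDiagram} (T : SemistandardYoungTableau μ) {k : ℕ}
    (hk : k ≤ N) :
    chainSize (tableauChain N T) k = (μ.cells.filter fun u => T u.1 u.2 < k).card := by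
  rw [chainSize, Finset.card_eq_sum_card_fiberwise (f := Prod.fst) (t := Finset.range k)]
  · refine Finset.sum_congr rfl fun i _ => ?_
    rw [tableauChain, if_pos hk]
    refine Finset.card_bij (fun j _ => (i, j)) ?_ ?_ ?_
    · intro j hj
      simp only [Finset.mem_filter, Finset.mem_range] at hj ⊢
      exact ⟨⟨YoungDiagram.mem_iff_lt_rowLen.2 hj.1, hj.2⟩, trivial⟩
    · intro j _ j' _ h
      exact (Prod.mk.inj h).2
    · rintro ⟨i', j⟩ h
      simp only [Finset.mem_filter] at h
      obtain ⟨⟨h1, h2⟩, rfl⟩ := h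
      refine ⟨j, ?_, rfl⟩
      simp only [Finset.mem_filter, Finset.mem_range]
      exact ⟨YoungDiagram.mem_iff_lt_rowLen.1 h1, h2⟩
  · rintro ⟨i, j⟩ h
    simp only [Finset.coe_filter, Set.mem_ofPred_eq, Finset.coe_range, Set.mem_Iio] at h ⊢
    exact (le_entry T h.1).trans_lt h.2

theorem gtPatterns_monotone {N : ℕ} {L : ℕ → ℕ → ℕ} (hL : L ∈ gtPatterns N) (i : ℕ) {k k' : ℕ}
    (hkk' : k ≤ k') (hk' : k' ≤ N) : L k i ≤ L k' i := by
  induction k', hkk' using Nat.le_induction with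
  | base => exact le_rfl
  | succ k' _ ih => exact (ih (by omega)).trans (hL.2.1 k' hk' i).2

theorem gtPatterns_antitone {N : ℕ} {L : ℕ → ℕ → ℕ} (hL : L ∈ gtPatterns N) (k : ℕ) :
    Antitone (L k) := by
  refine antitone_nat_of_succ_le fun i => ?_
  rcases Nat.eq_zero_or_pos k with rfl | hk
  · rw [hL.1]; exact le_rfl
  · by_cases hkN : k ≤ N
    · obtain ⟨k, rfl⟩ : ∃ j, k = j + 1 := ⟨k - 1, by omega⟩
      exact (hL.2.1 k hkN i).1.trans (hL.2.1 k hkN i).2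
    · rw [hL.2.2 k (by omega)]; exact le_rfl

/-- The entries of the tableau with chain `L`. -/
def chainEntry (N : ℕ) (L : ℕ → ℕ → ℕ) (i j : ℕ) : ℕ :=
  ((Finset.range N).filter fun k => L (k + 1) i ≤ j).card

theorem lt_chainEntry_iff {N : ℕ} {L : ℕ → ℕ → ℕ} (hL : L ∈ gtPatterns N) {i j k : ℕ} :
    k < chainEntry N L i j ↔ k < N ∧ L (k + 1) i ≤ j := by
  rw [chainEntry, ← mem_iff_lt_card_of_lower, Finset.mem_filter, Finset.mem_range]
  intro k k' hkk' hk'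
  rw [Finset.mem_filter, Finset.mem_range] at hk' ⊢
  exact ⟨by omega, (gtPatterns_monotone hL i (by omega) (by omega)).trans hk'.2⟩

theorem chainEntry_lt_iff {N : ℕ} {L : ℕ → ℕ → ℕ} (hL : L ∈ gtPatterns N) {i j k : ℕ}
    (hk : k ≤ N) : chainEntry N L i j < k ↔ j < L k i := by
  cases k with
  | zero => rw [hL.1]; simp
  | succ k =>
    rw [Nat.lt_succ_iff, ← not_lt, lt_chainEntry_iff hL, not_and, not_le]
    exact ⟨fun h => h hk, fun h _ => h⟩

/-- The tableau with chain `L`. -/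
def chainTableau {N : ℕ} {L : ℕ → ℕ → ℕ} (hL : L ∈ gtPatterns N) (μ : YoungDiagram)
    (hμ : L N = μ.rowLen) : SemistandardYoungTableau μ where
  entry i j := if (i, j) ∈ μ then chainEntry N L i j else 0
  row_weak' {i j1 j2} hj h := by
    rw [if_pos h, if_pos (μ.up_left_mem le_rfl hj.le h)]
    refine Finset.card_le_card fun k hk => ?_
    rw [Finset.mem_filter] at hk ⊢
    exact ⟨hk.1, hk.2.trans hj.le⟩
  col_strict' {i1 i2 j} hi h := by
    rw [if_pos h, if_pos (μ.up_left_mem hi.le le_rfl h)]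
    have h0 : chainEntry N L i2 j < N := by
      rw [chainEntry_lt_iff hL le_rfl, hμ]
      exact YoungDiagram.mem_iff_lt_rowLen.1 h
    rw [chainEntry_lt_iff hL h0.le]
    have h1 : j < L (chainEntry N L i2 j + 1) i2 :=
      (chainEntry_lt_iff hL (by omega)).1 (Nat.lt_succ_self _)
    exact (h1.trans_le (gtPatterns_antitone hL _ (Nat.succ_le_of_lt hi))).trans_le
      (hL.2.1 _ h0 i1).1
  zeros' h := if_neg h

theorem tableauChain_chainTableau {N : ℕ} {L : ℕ → ℕ → ℕ} (hL : L ∈ gtPatterns N)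
    (μ : YoungDiagram) (hμ : L N = μ.rowLen) : tableauChain N (chainTableau hL μ hμ) = L := by
  funext k i
  by_cases hk : k ≤ N
  · refine eq_of_forall_lt_iff fun j => ?_
    rw [lt_tableauChain_iff _ hk, ← hμ]
    change _ ∧ (if (i, j) ∈ μ then chainEntry N L i j else 0) < k ↔ _
    have hmem : (i, j) ∈ μ ↔ j < L N i := by rw [YoungDiagram.mem_iff_lt_rowLen, hμ]
    constructor
    · rintro ⟨h1, h2⟩
      rw [if_pos (hmem.2 h1)] at h2
      exact (chainEntry_lt_iff hL hk).1 h2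
    · intro h
      have h1 := h.trans_le (gtPatterns_monotone hL i hk le_rfl)
      rw [if_pos (hmem.2 h1)]
      exact ⟨h1, (chainEntry_lt_iff hL hk).2 h⟩
  · rw [hL.2.2 k (by omega), tableauChain, if_neg hk]
    rfl

theorem sum_single_entry_apply {μ : YoungDiagram} (T : SemistandardYoungTableau μ) (c : Fin r)
    (k : ℕ) :
    (∑ u ∈ μ.cells, Finsupp.single (c, T u.1 u.2) 1 : Fin r × ℕ →₀ ℕ) (c, k) =
      (μ.cells.filter fun u => T u.1 u.2 = k).card := by
  classical
  rw [Finsupp.finsetSum_apply, Finset.card_filter]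
  refine Finset.sum_congr rfl fun u _ => ?_
  simp [Finsupp.single_apply]

theorem card_filter_lt_succ {μ : YoungDiagram} (T : SemistandardYoungTableau μ) (k : ℕ) :
    (μ.cells.filter fun u => T u.1 u.2 < k + 1).card =
      (μ.cells.filter fun u => T u.1 u.2 < k).card +
        (μ.cells.filter fun u => T u.1 u.2 = k).card := by
  classical
  rw [← Finset.card_union_of_disjoint, ← Finset.filter_or]
  · simp only [Nat.lt_succ_iff_lt_or_eq]
  · refine Finset.disjoint_filter.2 fun u _ h h' => ?_
    omega

/-- The Gelfand–Tsetlin patterns of given content. -/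
def gtPatternsOfContent (N : ℕ) (m : ℕ → ℕ) : Set (ℕ → ℕ → ℕ) :=
  {L | L ∈ gtPatterns N ∧ ∀ k < N, chainSize L (k + 1) = chainSize L k + m k}

/-- The bound `N` exceeds every index occurring in `m`, so all the entries are less than `N` and the
chain ends at the full shape. The content is the sequence of size increments of the chain. -/
theorem ncard_tableaux {N : ℕ} {c : Fin r} {m : Fin r × ℕ →₀ ℕ}
    (hm : ∀ x, m x ≠ 0 → x.1 = c ∧ x.2 < N) (μ : YoungDiagram) :
    {T : SemistandardYoungTableau μ |
      ∑ u ∈ μ.cells, Finsupp.single (c, T u.1 u.2) 1 = m}.ncard =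
    {L | L ∈ gtPatternsOfContent N (fun k => m (c, k)) ∧ L N = μ.rowLen}.ncard := by
  classical
  have hlt : ∀ T : SemistandardYoungTableau μ,
      ∑ u ∈ μ.cells, Finsupp.single (c, T u.1 u.2) 1 = m → ∀ i j, (i, j) ∈ μ → T i j < N := by
    intro T hT i j hij
    refine (hm (c, T i j) ?_).2
    rw [← hT, sum_single_entry_apply]
    refine (Finset.card_pos.2 ⟨(i, j), ?_⟩).ne'
    exact Finset.mem_filter.2 ⟨hij, rfl⟩
  refine Set.ncard_congr (fun T _ => tableauChain N T) ?_ ?_ ?_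
  · intro T hT
    refine ⟨⟨tableauChain_mem T, fun k hk => ?_⟩, ?_⟩
    · rw [chainSize_tableauChain T hk, chainSize_tableauChain T hk.le, card_filter_lt_succ,
        ← sum_single_entry_apply T c, hT]
    · funext i
      rw [tableauChain, if_pos le_rfl, Finset.filter_true_of_mem, Finset.card_range]
      intro j hj
      exact hlt T hT i j (YoungDiagram.mem_iff_lt_rowLen.2 (Finset.mem_range.1 hj))
  · intro T T' hT hT' h
    ext i j
    by_cases hij : (i, j) ∈ μ
    · have hj := YoungDiagram.mem_iff_lt_rowLen.1 hij
      have key : ∀ k ≤ N, T i j < k ↔ T' i j < k := by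
        intro k hk
        have h1 := lt_tableauChain_iff (j := j) (i := i) T hk
        have h2 := lt_tableauChain_iff (j := j) (i := i) T' hk
        rw [h] at h1
        simpa [hj] using h1.symm.trans h2
      have h1 := hlt T hT i j hij
      have h2 := hlt T' hT' i j hij
      have h3 := key (T i j + 1) h1
      have h4 := key (T' i j + 1) h2
      omega
    · rw [T.zeros hij, T'.zeros hij]
  · rintro L ⟨⟨hL, hc⟩, hμ⟩
    refine ⟨chainTableau hL μ hμ, ?_, tableauChain_chainTableau hL μ hμ⟩
    have hchain := tableauChain_chainTableau hL μ hμ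
    set T := chainTableau hL μ hμ
    have hN : ∀ i j, (i, j) ∈ μ → T i j < N := by
      intro i j hij
      have hj := YoungDiagram.mem_iff_lt_rowLen.1 hij
      rw [← hμ, ← hchain] at hj
      exact ((lt_tableauChain_iff T le_rfl).1 hj).2
    change ∑ u ∈ μ.cells, Finsupp.single (c, T u.1 u.2) 1 = m
    ext ⟨c', k⟩
    by_cases hck : c' = c ∧ k < N
    · obtain ⟨rfl, hk⟩ := hck
      have h1 : _ = _ + m (c', k) := hc k hk
      rw [← hchain, chainSize_tableauChain T hk, chainSize_tableauChain T hk.le,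
        card_filter_lt_succ, ← sum_single_entry_apply T c'] at h1
      omega
    · rw [show m (c', k) = 0 from not_not.1 fun h => hck (hm _ h), Finsupp.finsetSum_apply]
      refine Finset.sum_eq_zero fun u hu => ?_
      rw [Finsupp.single_apply, if_neg]
      intro h
      obtain ⟨rfl, rfl⟩ := Prod.mk.inj h
      exact hck ⟨rfl, hN _ _ hu⟩

theorem sum_neg_one_pow_eq_ite_odd (n : ℕ) :
    ∑ i ∈ Finset.range n, (-1 : ℤ) ^ i = if Odd n then 1 else 0 := by
  rw [neg_one_geom_sum]
  by_cases h : Even n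
  · simp [h, Nat.not_odd_iff_even.2 h]
  · simp [h, Nat.not_even_iff_odd.1 h]

/-- Summing the signs `(-1) ^ i` column by column, a column of even length contributes `0` and one
of odd length contributes `1`. -/
theorem altSum_rowLen {N : ℕ} {μ : YoungDiagram} (hμ : ∀ i, N ≤ i → μ.rowLen i = 0) :
    altSum N μ.rowLen = oddColumns μ := by
  have h1 : ∀ i, (μ.rowLen i : ℤ) =
      ∑ j ∈ Finset.range (μ.rowLen 0), if i < μ.colLen j then 1 else 0 := by
    intro i
    rw [Finset.sum_boole]
    congr 1
    rw [← Finset.card_range (μ.rowLen i)]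
    congr 1
    ext j
    have := μ.rowLen_anti 0 i (Nat.zero_le _)
    rw [Finset.mem_filter, Finset.mem_range, Finset.mem_range, ← YoungDiagram.mem_iff_lt_colLen,
      YoungDiagram.mem_iff_lt_rowLen]
    omega
  have h2 : ∀ j, μ.colLen j ≤ N := by
    intro j
    by_contra! h
    have := YoungDiagram.mem_iff_lt_rowLen.1 (YoungDiagram.mem_iff_lt_colLen.2 h)
    rw [hμ N le_rfl] at this
    omega
  simp only [altSum, h1, Finset.mul_sum]
  rw [Finset.sum_comm, oddColumns, Finset.card_filter]
  push_cast
  refine Finset.sum_congr rfl fun j _ => ?_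
  simp only [mul_ite, mul_one, mul_zero]
  rw [← Finset.sum_filter, ← sum_neg_one_pow_eq_ite_odd]
  refine Finset.sum_congr ?_ fun _ _ => rfl
  ext i
  have := h2 j
  simp only [Finset.mem_filter, Finset.mem_range]
  omega

theorem exists_rowLen_eq {N : ℕ} {v : ℕ → ℕ} (hv : Antitone v) (hN : ∀ i, N ≤ i → v i = 0) :
    ∃ μ : YoungDiagram, μ.rowLen = v ∧ μ.card = ∑ i ∈ Finset.range N, v i := by
  classical
  have hmem : ∀ x : ℕ × ℕ, x ∈ (Finset.range N ×ˢ Finset.range (v 0)).filter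
      (fun x => x.2 < v x.1) ↔ x.2 < v x.1 := by
    intro x
    simp only [Finset.mem_filter, Finset.mem_product, Finset.mem_range, and_iff_right_iff_imp]
    intro h
    refine ⟨?_, h.trans_le (hv (Nat.zero_le _))⟩
    by_contra! hx
    rw [hN _ hx] at h
    omega
  refine ⟨⟨(Finset.range N ×ˢ Finset.range (v 0)).filter fun x => x.2 < v x.1, ?_⟩, ?_, ?_⟩
  · intro x y h hx
    rw [Finset.mem_coe, hmem] at hx ⊢
    exact (h.2.trans_lt hx).trans_le (hv h.1)
  · funext i
    refine eq_of_forall_lt_iff fun j => ?_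
    rw [← YoungDiagram.mem_iff_lt_rowLen]
    exact hmem (i, j)
  · rw [YoungDiagram.card, Finset.card_filter, Finset.sum_product]
    refine Finset.sum_congr rfl fun i _ => ?_
    rw [← Finset.card_filter]
    conv_rhs => rw [← Finset.card_range (v i)]
    congr 1
    ext j
    have := hv (Nat.zero_le i)
    simp only [Finset.mem_filter, Finset.mem_range]
    omega

end Tableaux

/-! ### Symmetric matrices as multiplicity functions of monomials -/

section SymmetricMatrices

/-- The indices of the independent entries of a symmetric matrix: `Sum.inl i` for the diagonal entry
`(i, i)` and `Sum.inr (i, j)` for the entries `(i, j)` and `(j, i)`, where `i < j`. -/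
abbrev SymIndex : Type :=
  ℕ ⊕ {q : ℕ × ℕ // q.1 < q.2}

/-- The index of the entry `(i, j)` of a symmetric matrix. -/
def symIndex (i j : ℕ) : SymIndex :=
  if h : i < j then Sum.inr ⟨(i, j), h⟩
  else if h : j < i then Sum.inr ⟨(j, i), h⟩
  else Sum.inl i

theorem symIndex_self (i : ℕ) : symIndex i i = Sum.inl i := by
  simp [symIndex]

theorem symIndex_of_lt {i j : ℕ} (h : i < j) : symIndex i j = Sum.inr ⟨(i, j), h⟩ := by
  simp [symIndex, h]

theorem symIndex_comm (i j : ℕ) : symIndex i j = symIndex j i := by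
  rcases lt_trichotomy i j with h | rfl | h
  · simp [symIndex, h, h.not_gt]
  · rfl
  · simp [symIndex, h, h.not_gt]

theorem symIndex_eq_inl {i j k : ℕ} : symIndex i j = Sum.inl k ↔ i = k ∧ j = k := by
  unfold symIndex
  split_ifs with h h'
  · simp; omega
  · simp; omega
  · simp; omega

theorem symIndex_eq_inr {i j : ℕ} {q : {q : ℕ × ℕ // q.1 < q.2}} :
    symIndex i j = Sum.inr q ↔ (i = q.1.1 ∧ j = q.1.2) ∨ (i = q.1.2 ∧ j = q.1.1) := by
  obtain ⟨⟨a, b⟩, hq⟩ := q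
  simp only at hq
  unfold symIndex
  split_ifs with h h'
  · simp; omega
  · simp; omega
  · simp; omega

theorem symIndex_injective (i : ℕ) : Function.Injective (symIndex i) := by
  intro j j' h
  rcases h' : symIndex i j' with k | q
  · rw [h', symIndex_eq_inl] at h
    rw [symIndex_eq_inl] at h'
    omega
  · rw [h', symIndex_eq_inr] at h
    rw [symIndex_eq_inr] at h'
    omega

variable {r : ℕ}

/-- The monomials whose multiplicities form a symmetric matrix for each color. -/
def symExponent (x : Fin r × SymIndex) : Fin r × ℕ →₀ ℕ :=
  Sum.elim (fun i => Finsupp.single (x.1, i) 1)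
    (fun q => Finsupp.single (x.1, q.1.1) 1 + Finsupp.single (x.1, q.1.2) 1) x.2

/-- The exponent of `x_i^{(c)}` is `1` or `0` according to whether the independent entry meets row
`i` of the matrix of color `c`; a diagonal entry meets its row once. Hence total exponents are row
sums. -/
theorem symExponent_apply (c' : Fin r) (t : SymIndex) (c : Fin r) (i : ℕ) :
    (c' = c ∧ ∃ j, symIndex i j = t) ∧ symExponent (c', t) (c, i) = 1 ∨
      ¬ (c' = c ∧ ∃ j, symIndex i j = t) ∧ symExponent (c', t) (c, i) = 0 := by
  classical
  by_cases hc : c' = c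
  · subst hc
    rcases t with k | ⟨⟨a, b⟩, hq⟩
    · simp only [symIndex_eq_inl, symExponent, Sum.elim_inl, Finsupp.single_apply,
        Prod.mk.injEq, true_and]
      by_cases h : k = i
      · left; simp [h]
      · right; simp [h, Ne.symm h]
    · simp only [symIndex_eq_inr, symExponent, Sum.elim_inr, Finsupp.single_apply,
        Prod.mk.injEq, true_and, Finsupp.add_apply]
      simp only at hq
      by_cases h : a = i
      · left
        subst h
        exact ⟨⟨b, by simp⟩, by simp [hq.ne']⟩
      · by_cases h' : b = i
        · left
          subst h'
          exact ⟨⟨a, by simp⟩, by simp [hq.ne]⟩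
        · right
          refine ⟨?_, by simp [h, h']⟩
          rintro ⟨j, h1 | h1⟩ <;> omega
  · right
    refine ⟨fun h => hc h.1, ?_⟩
    rcases t with k | q <;> simp [symExponent, hc]

theorem symExponent_locallyFinite : LocallyFiniteMonomials (symExponent (r := r)) where
  ne_zero := by
    rintro ⟨c, t⟩ h
    rcases t with k | q
    · have := symExponent_apply c (Sum.inl k) c k
      rw [h] at this
      simp [symIndex_eq_inl] at this
    · have := symExponent_apply c (Sum.inr q) c q.1.1
      rw [h] at this
      simp [symIndex_eq_inr] at this
  finite_le m := by
    classical
    refine (Finset.finite_toSet (((m.support ×ˢ m.support).image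
      fun x => (x.1.1, symIndex x.1.2 x.2.2)))).subset ?_
    rintro ⟨c, t⟩ h
    have key : ∀ i j, symIndex i j = t → (c, i) ∈ m.support := by
      intro i j hij
      rw [Finsupp.mem_support_iff]
      have h1 := symExponent_apply c t c i
      have h2 : symExponent (c, t) (c, i) ≤ m (c, i) := h (c, i)
      have h3 : ∃ j, symIndex i j = t := ⟨j, hij⟩
      simp only [h3, and_self, true_and, not_true_eq_false, false_and, or_false] at h1
      omega
    obtain ⟨i, j, rfl⟩ : ∃ i j, symIndex i j = t := by
      rcases t with k | q
      · exact ⟨k, k, symIndex_self k⟩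
      · exact ⟨q.1.1, q.1.2, symIndex_of_lt q.2⟩
    rw [Finset.mem_coe, Finset.mem_image]
    exact ⟨((c, i), (c, j)), Finset.mem_product.2 ⟨key i j rfl, key j i (symIndex_comm _ _)⟩, rfl⟩

theorem totalExponent_symExponent_eq_finsum (A : Fin r × SymIndex →₀ ℕ) (c : Fin r) (i : ℕ) :
    totalExponent symExponent A (c, i) = ∑ᶠ j, A (c, symIndex i j) := by
  classical
  have hfin : ∀ A : Fin r × SymIndex →₀ ℕ,
      (Function.support fun j => A (c, symIndex i j)).Finite := by
    intro A
    refine (A.support.finite_toSet.preimage (f := fun j => (c, symIndex i j)) ?_).subset ?_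
    · intro j _ j' _ h
      exact symIndex_injective i (Prod.mk.inj h).2
    · intro j hj
      simpa using hj
  induction A using Finsupp.induction_linear with
  | zero => simp [totalExponent]
  | add A B hA hB =>
    rw [totalExponent_add, Finsupp.add_apply, hA, hB, ← finsum_add_distrib (hfin A) (hfin B)]
    rfl
  | single x k =>
    obtain ⟨c', t⟩ := x
    rw [totalExponent_single, Finsupp.smul_apply, smul_eq_mul]
    rcases symExponent_apply c' t c i with ⟨⟨rfl, j, rfl⟩, h⟩ | ⟨h1, h⟩
    · rw [h, mul_one, finsum_eq_single _ j]
      · simp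
      · intro j' hj'
        rw [Finsupp.single_apply, if_neg]
        intro h
        exact hj' (symIndex_injective i (Prod.mk.inj h).2).symm
    · rw [h, mul_zero, finsum_eq_zero_of_forall_eq_zero]
      intro j
      rw [Finsupp.single_apply, if_neg]
      intro h
      obtain ⟨rfl, rfl⟩ := Prod.mk.inj h
      exact h1 ⟨rfl, j, rfl⟩

theorem totalExponent_symExponent_apply {A : Fin r × SymIndex →₀ ℕ} {c : Fin r} {i N : ℕ}
    (hA : ∀ j, N ≤ j → A (c, symIndex i j) = 0) :
    totalExponent symExponent A (c, i) = ∑ j ∈ Finset.range N, A (c, symIndex i j) := by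
  rw [totalExponent_symExponent_eq_finsum]
  refine finsum_eq_sum_of_support_subset _ fun j hj => ?_
  simp only [Finset.coe_range, Set.mem_Iio]
  by_contra! h
  exact hj (hA j h)

/-- An entry is at most its row sum. Bounds on the support of the content thus become bounds on the
support of the matrix. -/
theorem apply_symIndex_le (A : Fin r × SymIndex →₀ ℕ) (c : Fin r) (i j : ℕ) :
    A (c, symIndex i j) ≤ totalExponent symExponent A (c, i) := by
  have h1 := smul_le_totalExponent symExponent A (c, symIndex i j) (c, i)
  have h2 := symExponent_apply c (symIndex i j) c i
  have h3 : ∃ j', symIndex i j' = symIndex i j := ⟨j, rfl⟩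
  simp only [h3, and_self, true_and, not_true_eq_false, false_and, or_false] at h2
  rwa [Finsupp.smul_apply, h2, smul_eq_mul, mul_one] at h1

variable {R : Type*} [CommRing R]

/-- The scalars of the monomials of a color: `p` for the diagonal entries and `1` for the others. -/
def symScalar (p : R) (t : SymIndex) : R :=
  Sum.elim (fun _ => p) (fun _ => 1) t

theorem scalarWeight_symScalar (p : R) {A : SymIndex →₀ ℕ} {N : ℕ}
    (hA : ∀ k, N ≤ k → A (Sum.inl k) = 0) :
    scalarWeight (symScalar p) A = p ^ ∑ k ∈ Finset.range N, A (Sum.inl k) := by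
  classical
  rw [← Finset.prod_pow_eq_pow_sum, scalarWeight,
    Finsupp.prod_of_support_subset A (s := A.support ∪ (Finset.range N).image Sum.inl)
      Finset.subset_union_left _ (by simp)]
  have himage : ∏ k ∈ Finset.range N, p ^ A (Sum.inl k) =
      ∏ t ∈ (Finset.range N).image Sum.inl, symScalar p t ^ A t := by
    rw [Finset.prod_image fun _ _ _ _ h => Sum.inl_injective h]
    rfl
  rw [himage]
  symm
  refine Finset.prod_subset Finset.subset_union_right ?_
  rintro (k | q) _ h
  · rw [hA k, pow_zero]
    by_contra! hk
    exact h (Finset.mem_image.2 ⟨k, Finset.mem_range.2 hk, rfl⟩)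
  · simp [symScalar]

end SymmetricMatrices

/-! ### Littlewood's identity in one color -/

section OneColor

variable {r : ℕ} (c : Fin r)

/-- The monomials of the color `c` whose multiplicities form a symmetric matrix. -/
def colorExponent (t : SymIndex) : Fin r × ℕ →₀ ℕ :=
  symExponent (c, t)

theorem colorExponent_locallyFinite : LocallyFiniteMonomials (colorExponent c) where
  ne_zero t := symExponent_locallyFinite.ne_zero (c, t)
  finite_le m := (symExponent_locallyFinite.finite_le m).preimage
    (Prod.mk_right_injective c).injOn

theorem totalExponent_colorExponent (A : SymIndex →₀ ℕ) :
    totalExponent (colorExponent c) A = totalExponent symExponent (A.mapDomain (Prod.mk c)) := by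
  rw [totalExponent, totalExponent, Finsupp.linearCombination_mapDomain]
  rfl

theorem apply_symIndex_le_colorExponent (A : SymIndex →₀ ℕ) (i j : ℕ) :
    A (symIndex i j) ≤ totalExponent (colorExponent c) A (c, i) := by
  rw [totalExponent_colorExponent]
  refine le_trans (le_of_eq ?_) (apply_symIndex_le _ c i j)
  rw [Finsupp.mapDomain_apply (Prod.mk_right_injective c)]

theorem totalExponent_colorExponent_apply {A : SymIndex →₀ ℕ} {i N : ℕ}
    (hA : ∀ j, N ≤ j → A (symIndex i j) = 0) :
    totalExponent (colorExponent c) A (c, i) = ∑ j ∈ Finset.range N, A (symIndex i j) := by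
  have h : ∀ t, A.mapDomain (Prod.mk c) (c, t) = A t := fun t =>
    Finsupp.mapDomain_apply (Prod.mk_right_injective c) _ _
  rw [totalExponent_colorExponent, totalExponent_symExponent_apply (N := N)]
  · simp only [h]
  · intro j hj
    rw [h, hA j hj]

theorem totalExponent_colorExponent_of_ne {c' : Fin r} (hc : c' ≠ c) (A : SymIndex →₀ ℕ) (i : ℕ) :
    totalExponent (colorExponent c) A (c', i) = 0 := by
  rw [totalExponent_colorExponent, totalExponent_symExponent_apply (N := 0)]
  · simp
  · intro j _
    rw [Finsupp.mapDomain_of_notMem_range]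
    rintro ⟨t, ht⟩
    exact hc (Prod.mk.inj ht).1.symm

/-- The lower triangular part of a symmetric matrix. -/
def toTriangular (N : ℕ) (A : SymIndex →₀ ℕ) (j i : ℕ) : ℕ :=
  if i ≤ j ∧ j < N then A (symIndex i j) else 0

/-- The lower triangular parts of the symmetric matrices with given row sums. -/
def triangularOfRowSums (N : ℕ) (m : ℕ → ℕ) : Set (ℕ → ℕ → ℕ) :=
  {B | B ∈ triangular N ∧ ∀ k < N, symRowSum N B k = m k}

theorem symRowSum_toTriangular {N k : ℕ} (hk : k < N) (A : SymIndex →₀ ℕ) :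
    symRowSum N (toTriangular N A) k = ∑ j ∈ Finset.range N, A (symIndex k j) := by
  refine Finset.sum_congr rfl fun j hj => ?_
  have := Finset.mem_range.1 hj
  rw [toTriangular, if_pos (by omega)]
  rcases le_total j k with h | h
  · rw [min_eq_left h, max_eq_right h, symIndex_comm]
  · rw [min_eq_right h, max_eq_left h]

theorem exists_symIndex_eq (t : SymIndex) : ∃ i j, i ≤ j ∧ symIndex i j = t := by
  rcases t with k | q
  · exact ⟨k, k, le_rfl, symIndex_self k⟩
  · exact ⟨q.1.1, q.1.2, q.2.le, symIndex_of_lt q.2⟩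

/-- Row sums vanish from index `N` on, hence so do all the entries there, and truncating to the
lower triangle loses nothing. -/
theorem bijOn_toTriangular {N : ℕ} {m : Fin r × ℕ →₀ ℕ}
    (hm : ∀ x, m x ≠ 0 → x.1 = c ∧ x.2 < N) :
    Set.BijOn (toTriangular N) (multiplicities (colorExponent c) Set.univ m)
      (triangularOfRowSums N fun k => m (c, k)) := by
  have hzero : ∀ A ∈ multiplicities (colorExponent c) Set.univ m, ∀ i j, N ≤ j →
      A (symIndex i j) = 0 := by
    intro A hA i j hj
    have h := apply_symIndex_le_colorExponent c A j i
    have h1 : m (c, j) = 0 := by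
      by_contra h0
      have := (hm _ h0).2
      simp only at this
      omega
    rw [hA.2, h1, symIndex_comm] at h
    omega
  refine ⟨?_, ?_, ?_⟩
  · intro A hA
    refine ⟨fun j i hij => by rw [toTriangular, if_neg hij], fun k hk => ?_⟩
    rw [symRowSum_toTriangular hk, ← totalExponent_colorExponent_apply c (hzero A hA k), hA.2]
  · intro A hA A' hA' h
    ext t
    obtain ⟨i, j, hij, rfl⟩ := exists_symIndex_eq t
    by_cases hj : j < N
    · have h1 := congrFun (congrFun h j) i
      rwa [toTriangular, if_pos ⟨hij, hj⟩, toTriangular, if_pos ⟨hij, hj⟩] at h1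
    · rw [hzero A hA i j (by omega), hzero A' hA' i j (by omega)]
  · rintro B ⟨hB, hBm⟩
    let g : SymIndex → ℕ := Sum.elim (fun k => B k k) (fun q => B q.1.2 q.1.1)
    have hg : ∀ i j, i ≤ j → g (symIndex i j) = B j i := by
      intro i j hij
      rcases hij.lt_or_eq with h | rfl
      · rw [symIndex_of_lt h]; rfl
      · rw [symIndex_self]; rfl
    have hfin : (Function.support g).Finite := by
      refine (Set.toFinite ((fun x : ℕ × ℕ => symIndex x.1 x.2) ''
        (Finset.range N ×ˢ Finset.range N : Finset (ℕ × ℕ)))).subset ?_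
      intro t ht
      obtain ⟨i, j, hij, rfl⟩ := exists_symIndex_eq t
      rw [Function.mem_support, hg i j hij] at ht
      refine ⟨(i, j), ?_, rfl⟩
      have h : j < N := by
        by_contra h
        exact ht (hB j i (by omega))
      simp only [Finset.coe_product, Finset.coe_range, Set.mem_prod, Set.mem_Iio]
      omega
    have htri : toTriangular N (Finsupp.ofSupportFinite g hfin) = B := by
      funext j i
      by_cases h : i ≤ j ∧ j < N
      · rw [toTriangular, if_pos h]
        exact hg i j h.1
      · rw [toTriangular, if_neg h, hB j i h]
    have hz : ∀ i j, N ≤ j → Finsupp.ofSupportFinite g hfin (symIndex i j) = 0 := by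
      intro i j hj
      change g _ = 0
      rcases le_total i j with h | h
      · rw [hg i j h, hB j i (by omega)]
      · rw [symIndex_comm, hg j i h, hB i j (by omega)]
    refine ⟨Finsupp.ofSupportFinite g hfin, ⟨Set.subset_univ _, ?_⟩, htri⟩
    ext ⟨c', k⟩
    by_cases hc : c' = c
    · subst hc
      rw [totalExponent_colorExponent_apply c' (hz k)]
      by_cases hk : k < N
      · rw [← symRowSum_toTriangular hk, htri]
        exact hBm k hk
      · rw [show m (c', k) = 0 from not_not.1 fun h => hk (hm _ h).2]
        refine Finset.sum_eq_zero fun j _ => ?_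
        rw [symIndex_comm]
        exact hz j k (by omega)
    · rw [totalExponent_colorExponent_of_ne c hc,
        show m (c', k) = 0 from not_not.1 fun h => hc (hm _ h).1]

/-- The Young diagrams with `n` cells. -/
def diagrams (n : ℕ) : Finset YoungDiagram :=
  ((finite_card_le n).subset (t := {μ | μ.card = n}) fun _ h => le_of_eq h).toFinset

theorem mem_diagrams {n : ℕ} {μ : YoungDiagram} : μ ∈ diagrams n ↔ μ.card = n := by
  simp [diagrams]

variable {R : Type*} [CommRing R]

theorem coeff_schur (μ : YoungDiagram) (m : Fin r × ℕ →₀ ℕ) :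
    MvPowerSeries.coeff m (schur R c μ) = ({T : SemistandardYoungTableau μ |
      ∑ u ∈ μ.cells, Finsupp.single (c, T u.1 u.2) 1 = m}.ncard : R) :=
  rfl

theorem coeff_schur_eq_zero_of_degree_ne {μ : YoungDiagram} {m : Fin r × ℕ →₀ ℕ}
    (h : m.degree ≠ μ.card) : MvPowerSeries.coeff m (schur R c μ) = 0 := by
  rw [coeff_schur, Set.eq_empty_of_forall_notMem (s := {T : SemistandardYoungTableau μ |
    ∑ u ∈ μ.cells, Finsupp.single (c, T u.1 u.2) 1 = m}), Set.ncard_empty, Nat.cast_zero]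
  rintro T rfl
  refine h ?_
  rw [map_sum]
  simp [Finsupp.degree_single, YoungDiagram.card]

theorem coeff_schur_eq_zero_of_color_ne {μ : YoungDiagram} {m : Fin r × ℕ →₀ ℕ} {x : Fin r × ℕ}
    (hx : x.1 ≠ c) (h : m x ≠ 0) : MvPowerSeries.coeff m (schur R c μ) = 0 := by
  classical
  rw [coeff_schur, Set.eq_empty_of_forall_notMem (s := {T : SemistandardYoungTableau μ |
    ∑ u ∈ μ.cells, Finsupp.single (c, T u.1 u.2) 1 = m}), Set.ncard_empty, Nat.cast_zero]
  rintro T rfl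
  refine h ?_
  rw [Finsupp.finsetSum_apply]
  refine Finset.sum_eq_zero fun u _ => ?_
  rw [Finsupp.single_apply, if_neg]
  rintro rfl
  exact hx rfl

theorem chainSize_eq_sum {N : ℕ} {L : ℕ → ℕ → ℕ} {m : ℕ → ℕ} (hL : L ∈ gtPatternsOfContent N m)
    {k : ℕ} (hk : k ≤ N) : chainSize L k = ∑ j ∈ Finset.range k, m j := by
  induction k with
  | zero => simp [chainSize]
  | succ k ih => rw [Finset.sum_range_succ, hL.2 k hk, ih (by omega)]

theorem degree_eq_sum_range {N : ℕ} {m : Fin r × ℕ →₀ ℕ}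
    (hm : ∀ x, m x ≠ 0 → x.1 = c ∧ x.2 < N) : m.degree = ∑ k ∈ Finset.range N, m (c, k) := by
  classical
  rw [Finsupp.degree_apply, ← Finset.sum_image (f := m) (g := Prod.mk c)
    (Prod.mk_right_injective c).injOn]
  refine Finset.sum_subset ?_ ?_
  · rintro ⟨c', k⟩ h
    obtain ⟨h1, h2⟩ := hm _ (Finsupp.mem_support_iff.1 h)
    simp only at h1 h2
    subst h1
    exact Finset.mem_image.2 ⟨k, Finset.mem_range.2 h2, rfl⟩
  · intro x _ h
    exact Finsupp.notMem_support_iff.1 h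

theorem sum_schur_eq_finsum {N : ℕ} {m : Fin r × ℕ →₀ ℕ}
    (hm : ∀ x, m x ≠ 0 → x.1 = c ∧ x.2 < N) (p : R) :
    ∑ μ ∈ diagrams m.degree, p ^ oddColumns μ * MvPowerSeries.coeff m (schur R c μ) =
      ∑ᶠ A ∈ multiplicities (colorExponent c) Set.univ m, scalarWeight (symScalar p) A := by
  classical
  obtain ⟨f, hf, hprop⟩ := exists_bijOn_gtPatterns_triangular N
  have hbij : Set.BijOn f (gtPatternsOfContent N fun k => m (c, k))
      (triangularOfRowSums N fun k => m (c, k)) := by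
    refine ⟨fun L hL => ⟨hf.mapsTo hL.1, fun k hk => ?_⟩, hf.injOn.mono fun L hL => hL.1, ?_⟩
    · have h1 := (hprop L hL.1).1 k hk
      have h2 := hL.2 k hk
      beta_reduce at h2 ⊢
      omega
    · rintro B ⟨hB, hBm⟩
      obtain ⟨L, hL, rfl⟩ := hf.surjOn hB
      refine ⟨L, ⟨hL, fun k hk => ?_⟩, rfl⟩
      rw [(hprop L hL).1 k hk, hBm k hk]
  have hbij' := bijOn_toTriangular c hm
  have hfinB : (triangularOfRowSums N fun k => m (c, k)).Finite := by
    rw [← hbij'.image_eq]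
    exact ((colorExponent_locallyFinite c).finite_multiplicities _ _).image _
  have hfinL : (gtPatternsOfContent N fun k => m (c, k)).Finite :=
    hfinB.of_injOn hbij.mapsTo hbij.injOn
  have hB : ∑ᶠ A ∈ multiplicities (colorExponent c) Set.univ m, scalarWeight (symScalar p) A =
      ∑ᶠ B ∈ triangularOfRowSums N fun k => m (c, k), p ^ ∑ k ∈ Finset.range N, B k k := by
    refine finsum_mem_eq_of_bijOn _ hbij' fun A hA => ?_
    rw [scalarWeight_symScalar p (N := N)]
    · congr 1
      refine Finset.sum_congr rfl fun k hk => ?_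
      rw [toTriangular, if_pos ⟨le_rfl, Finset.mem_range.1 hk⟩, symIndex_self]
    · intro k hk
      have h := apply_symIndex_le_colorExponent c A k k
      rw [symIndex_self, hA.2,
        show m (c, k) = 0 from not_not.1 fun h => by have := (hm _ h).2; simp only at this; omega]
        at h
      omega
  rw [hB, ← finsum_mem_eq_of_bijOn f hbij (fun _ _ => rfl), finsum_mem_eq_finite_toFinset_sum _ hfinL]
  have hcoeff : ∀ μ : YoungDiagram, p ^ oddColumns μ * MvPowerSeries.coeff m (schur R c μ) =
      ∑ L ∈ hfinL.toFinset, if L N = μ.rowLen then p ^ oddColumns μ else 0 := by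
    intro μ
    rw [coeff_schur, ncard_tableaux hm, ← Finset.sum_filter, Finset.sum_const, nsmul_eq_mul,
      mul_comm, ← Set.ncard_coe_finset]
    congr 3
    ext L
    simp
  rw [Finset.sum_congr rfl fun μ _ => hcoeff μ, Finset.sum_comm]
  refine Finset.sum_congr rfl fun L hL => ?_
  rw [Set.Finite.mem_toFinset] at hL
  have hvan : ∀ i, N ≤ i → L N i = 0 := fun i hi => gtPatterns_apply_eq_zero hL.1 hi
  -- After the exchange of sums each pattern meets exactly one shape, its last partition. The
  -- alternating sum of that partition is both the number of odd columns and the trace of the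
  -- matrix.
  obtain ⟨μ, hμ, hcard⟩ := exists_rowLen_eq (gtPatterns_antitone hL.1 N) hvan
  rw [Finset.sum_eq_single μ]
  · rw [if_pos hμ.symm]
    congr 1
    have h1 := altSum_rowLen (N := N) (μ := μ) (by rw [hμ]; exact hvan)
    rw [hμ, (hprop L hL.1).2] at h1
    exact_mod_cast h1.symm
  · intro ν _ hν
    rw [if_neg]
    intro h
    refine hν (YoungDiagram.ext ?_)
    ext ⟨i, j⟩
    rw [YoungDiagram.mem_cells, YoungDiagram.mem_cells, YoungDiagram.mem_iff_lt_rowLen,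
      YoungDiagram.mem_iff_lt_rowLen, hμ, h]
  · intro h
    refine absurd (mem_diagrams.2 ?_) h
    rw [hcard, degree_eq_sum_range c hm, ← chainSize_eq_sum hL le_rfl]
    rfl

/-- The Littlewood identity for the Schur functions of a color, by the number of odd columns. -/
theorem mk_sum_schur (p : R) :
    PowerSeries.mk (fun n => ∑ μ ∈ diagrams n, p ^ oddColumns μ • schur R c μ) =
      multiplicitySeries (colorExponent c) (symScalar p) Set.univ := by
  classical
  ext n m
  rw [PowerSeries.coeff_mk, coeff_multiplicitySeries, map_sum]
  simp only [map_smul, smul_eq_mul]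
  by_cases hn : m.degree = n
  · subst hn
    rw [if_pos rfl]
    by_cases hm : ∀ x, m x ≠ 0 → x.1 = c
    · refine sum_schur_eq_finsum c (N := m.support.sup Prod.snd + 1) (fun x hx => ⟨hm x hx, ?_⟩) p
      exact Nat.lt_succ_iff.2 (Finset.le_sup (f := Prod.snd) (Finsupp.mem_support_iff.2 hx))
    · push Not at hm
      obtain ⟨⟨c', i⟩, hx, hc⟩ := hm
      rw [Finset.sum_eq_zero, Set.eq_empty_of_forall_notMem (s := multiplicities _ _ _),
        finsum_mem_empty]
      · rintro A ⟨-, hA⟩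
        refine hx ?_
        rw [← hA, totalExponent_colorExponent_of_ne c hc]
      · intro μ _
        rw [coeff_schur_eq_zero_of_color_ne c hc hx, mul_zero]
  · rw [if_neg hn]
    refine Finset.sum_eq_zero fun μ hμ => ?_
    rw [coeff_schur_eq_zero_of_degree_ne c, mul_zero]
    rwa [mem_diagrams.1 hμ]

end OneColor

/-! ### Labeled involutions and symmetric matrices -/

section Standardization

variable {n : ℕ} {Λ : Type*} [LinearOrder Λ]

theorem eq_of_monotone_of_card_fiber_eq {f g : Fin n → Λ} (hf : Monotone f) (hg : Monotone g)
    (h : ∀ a, (Finset.univ.filter fun k => f k = a).card =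
      (Finset.univ.filter fun k => g k = a).card) : f = g := by
  have key : (Finset.univ.val.map f : Multiset Λ) = Finset.univ.val.map g := by
    ext a
    rw [Multiset.count_map, Multiset.count_map]
    simpa only [Finset.card_def, Finset.filter_val, eq_comm] using h a
  rw [Fin.univ_val_map, Fin.univ_val_map, Multiset.coe_eq_coe] at key
  exact List.ofFn_injective (key.eq_of_sortedLE (List.sortedLE_ofFn_iff.2 hf)
    (List.sortedLE_ofFn_iff.2 hg))

/-- The labeled involutions: `u` is an involution, the labels `l` are weakly increasing, and `u` is
increasing on the positions of a given label. -/
def LabeledInvolution (u : Fin n → Fin n) (l : Fin n → Λ) : Prop :=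
  Function.Involutive u ∧ StrictMono fun k => toLex (l k, u k)

theorem LabeledInvolution.lt_or {u : Fin n → Fin n} {l : Fin n → Λ} (h : LabeledInvolution u l)
    {k k' : Fin n} (hk : k < k') : l k < l k' ∨ l k = l k' ∧ u k < u k' :=
  Prod.Lex.toLex_lt_toLex.1 (h.2 hk)

theorem LabeledInvolution.monotone {u : Fin n → Fin n} {l : Fin n → Λ}
    (h : LabeledInvolution u l) : Monotone l := by
  intro k k' hk
  rcases hk.lt_or_eq with hk | rfl
  · rcases h.lt_or hk with h | h
    exacts [h.le, h.1.le]
  · exact le_rfl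

theorem LabeledInvolution.lt_of_eq {u : Fin n → Fin n} {l : Fin n → Λ}
    (h : LabeledInvolution u l) {k k' : Fin n} (hk : k < k') (hl : l k = l k') : u k < u k' := by
  rcases h.lt_or hk with h | h
  exacts [absurd hl h.ne, h.2]

/-- On positions with a common label `u` is increasing, but a cycle `k < u k` would be reversed by
`u`. -/
theorem LabeledInvolution.fixed_of_label_eq {u : Fin n → Fin n} {l : Fin n → Λ}
    (h : LabeledInvolution u l) {k : Fin n} (hl : l k = l (u k)) : u k = k := by
  rcases lt_trichotomy k (u k) with hk | hk | hk
  · have := h.lt_of_eq hk hl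
    rw [h.1 k] at this
    exact absurd hk this.asymm
  · exact hk.symm
  · have := h.lt_of_eq hk hl.symm
    rw [h.1 k] at this
    exact absurd hk this.asymm

theorem LabeledInvolution.monotone_pair {u : Fin n → Fin n} {l : Fin n → Λ}
    (h : LabeledInvolution u l) : Monotone fun k => toLex (l k, l (u k)) := by
  intro k k' hk
  rcases hk.lt_or_eq with hk | rfl
  · rw [Prod.Lex.toLex_le_toLex]
    rcases h.lt_or hk with h' | h'
    · exact Or.inl h'
    · exact Or.inr ⟨h'.1, h.monotone h'.2.le⟩
  · exact le_rfl

/-- The matrix which counts the positions `k` by the labels of `k` and `u k`. -/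
def labelMatrix (u : Fin n → Fin n) (l : Fin n → Λ) (x y : Λ) : ℕ :=
  (Finset.univ.filter fun k => l k = x ∧ l (u k) = y).card

/-- The matrix gives the multiplicities of the pairs (label of `k`, label of `u k`), and these pairs
are sorted, so the labels agree. Then `u' ∘ u` is a strictly increasing surjection of `Fin n`, hence
the identity. -/
theorem LabeledInvolution.eq_of_labelMatrix_eq {u u' : Fin n → Fin n} {l l' : Fin n → Λ}
    (h : LabeledInvolution u l) (h' : LabeledInvolution u' l')
    (hM : ∀ x y, labelMatrix u l x y = labelMatrix u' l' x y) : u = u' ∧ l = l' := by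
  have hP : (fun k => toLex (l k, l (u k))) = fun k => toLex (l' k, l' (u' k)) := by
    refine eq_of_monotone_of_card_fiber_eq h.monotone_pair h'.monotone_pair fun a => ?_
    have key := hM (ofLex a).1 (ofLex a).2
    have conv : ∀ x y : Λ, toLex (x, y) = a ↔ x = (ofLex a).1 ∧ y = (ofLex a).2 := by
      intro x y
      rw [← toLex_ofLex a, toLex_inj, ofLex_toLex, Prod.ext_iff]
    simpa only [labelMatrix, conv] using key
  have hpair : ∀ k, l k = l' k ∧ l (u k) = l' (u' k) := fun k =>
    Prod.mk.inj (toLex_inj.1 (congrFun hP k))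
  have hl : l = l' := funext fun k => (hpair k).1
  subst hl
  refine ⟨?_, rfl⟩
  have hv : StrictMono (u' ∘ u) := by
    intro k k' hk
    have e : ∀ k, l (u' (u k)) = l k := by
      intro k
      rw [← (hpair (u k)).2, h.1 k]
    -- A failure forces `l k = l k'`, hence `u k < u k'`. If the labels of `u k` and `u k'` differ,
    -- the sorted pairs of `u'` are violated; if they agree, `u'` fails to increase on a common
    -- label.
    by_contra! hle
    have h1 : l (u' (u k')) ≤ l (u' (u k)) := h.monotone hle
    rw [e, e] at h1
    have h2 : l k = l k' := le_antisymm (h.monotone hk.le) h1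
    have h3 : u k < u k' := h.lt_of_eq hk h2
    rcases (h.monotone h3.le).lt_or_eq with h4 | h4
    · have h5 := (h'.monotone_pair hle)
      simp only [Function.comp_apply, Prod.Lex.toLex_le_toLex] at h5
      rw [e, e, h'.1, h'.1] at h5
      rcases h5 with h5 | h5
      · exact absurd h2 h5.ne'
      · exact absurd h5.2 (not_le.2 h4)
    · exact absurd (h'.lt_of_eq h3 h4) (not_lt.2 hle)
  have hid : u' ∘ u = id := by
    refine (hv.range_inj strictMono_id).1 ?_
    rw [(h'.1.surjective.comp h.1.surjective).range_eq, Set.range_id]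
  funext k
  have := congrFun hid k
  simp only [Function.comp_apply, id_eq] at this
  rw [← h'.1 (u k), this]

theorem toLex_triple_lt_iff {x y x' y' : Λ} {t t' : ℕ} :
    toLex (x, toLex (y, t)) < toLex (x', toLex (y', t')) ↔
      x < x' ∨ x = x' ∧ (y < y' ∨ y = y' ∧ t < t') := by
  rw [Prod.Lex.toLex_lt_toLex, Prod.Lex.toLex_lt_toLex]

theorem exists_labeledInvolution {B : Λ → Λ → ℕ} (hsymm : ∀ x y, B x y = B y x) (S : Finset Λ)
    (hS : ∀ x y, B x y ≠ 0 → x ∈ S) :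
    ∃ (n : ℕ) (u : Fin n → Fin n) (l : Fin n → Λ), LabeledInvolution u l ∧
      ∀ x y, labelMatrix u l x y = B x y := by
  classical
  -- The positions are the triples `(x, y, t)` with `t < B x y` in lexicographic order. The
  -- involution swaps `x` and `y`, keeping the copy number `t`.
  let E : Finset (Λ ×ₗ (Λ ×ₗ ℕ)) := (S ×ˢ S).biUnion fun q =>
    (Finset.range (B q.1 q.2)).image fun t => toLex (q.1, toLex (q.2, t))
  have hE : ∀ x y t, toLex (x, toLex (y, t)) ∈ E ↔ t < B x y := by
    intro x y t
    simp only [E, Finset.mem_biUnion, Finset.mem_product, Finset.mem_image, Finset.mem_range]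
    constructor
    · rintro ⟨⟨x', y'⟩, -, t', ht, h⟩
      dsimp only at ht h
      have h1 := Prod.mk.inj (toLex_inj.1 h)
      have h2 := Prod.mk.inj (toLex_inj.1 h1.2)
      rwa [← h1.1, ← h2.1, ← h2.2]
    · intro h
      have h0 : B x y ≠ 0 := by omega
      exact ⟨(x, y), ⟨hS x y h0, hS y x (hsymm x y ▸ h0)⟩, t, h, rfl⟩
  let e : Fin E.card ≃o E := E.orderIsoOfFin rfl
  let l : Fin E.card → Λ := fun k => (ofLex (e k).1).1
  let y : Fin E.card → Λ := fun k => (ofLex (ofLex (e k).1).2).1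
  let t : Fin E.card → ℕ := fun k => (ofLex (ofLex (e k).1).2).2
  have he : ∀ k, (e k).1 = toLex (l k, toLex (y k, t k)) := fun k => rfl
  have ht : ∀ k, t k < B (l k) (y k) := fun k => (hE _ _ _).1 (he k ▸ (e k).2)
  let u : Fin E.card → Fin E.card := fun k =>
    e.symm ⟨toLex (y k, toLex (l k, t k)), (hE _ _ _).2 (hsymm (l k) (y k) ▸ ht k)⟩
  have heu : ∀ k, (e (u k)).1 = toLex (y k, toLex (l k, t k)) := fun k => by
    simp only [u, OrderIso.apply_symm_apply]
  have hlu : ∀ k, l (u k) = y k := fun k => by simp only [l, heu, ofLex_toLex]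
  have hyu : ∀ k, y (u k) = l k := fun k => by simp only [y, heu, ofLex_toLex]
  have htu : ∀ k, t (u k) = t k := fun k => by simp only [t, heu, ofLex_toLex]
  have hlt : ∀ k k', k < k' ↔ l k < l k' ∨ l k = l k' ∧ (y k < y k' ∨ y k = y k' ∧ t k < t k') := by
    intro k k'
    rw [← e.lt_iff_lt, ← Subtype.coe_lt_coe, he, he, toLex_triple_lt_iff]
  refine ⟨E.card, u, l, ⟨fun k => ?_, fun k k' hk => ?_⟩, fun x z => ?_⟩
  · apply e.injective
    apply Subtype.ext
    rw [heu, hlu, hyu, htu, he]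
  · change toLex (l k, u k) < toLex (l k', u k')
    rw [Prod.Lex.toLex_lt_toLex]
    rcases (hlt k k').1 hk with h | ⟨h1, h2⟩
    · exact Or.inl h
    · refine Or.inr ⟨h1, (hlt _ _).2 ?_⟩
      rw [hlu, hlu, hyu, hyu, htu, htu]
      rcases h2 with h2 | ⟨h2, h3⟩
      · exact Or.inl h2
      · exact Or.inr ⟨h2, Or.inr ⟨h1, h3⟩⟩
  · rw [labelMatrix, ← Finset.card_range (B x z)]
    refine Finset.card_bij (fun k _ => t k) ?_ ?_ ?_
    · intro k hk
      simp only [Finset.mem_filter, Finset.mem_univ, true_and, hlu] at hk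
      rw [Finset.mem_range, ← hk.1, ← hk.2]
      exact ht k
    · intro k hk k' hk' h
      simp only [Finset.mem_filter, Finset.mem_univ, true_and, hlu] at hk hk'
      apply e.injective
      apply Subtype.ext
      rw [he, he, h, hk.1, hk.2, hk'.1, hk'.2]
    · intro s hs
      have hs' := (hE x z s).2 (Finset.mem_range.1 hs)
      have hk : (e (e.symm ⟨_, hs'⟩)).1 = toLex (x, toLex (z, s)) := by
        rw [OrderIso.apply_symm_apply]
      refine ⟨e.symm ⟨_, hs'⟩, ?_, ?_⟩
      · simp only [Finset.mem_filter, Finset.mem_univ, true_and, hlu]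
        simp only [l, y, hk, ofLex_toLex, and_self]
      · simp only [t, hk, ofLex_toLex]

end Standardization

/-! ### The order on the variables -/

section Labels

variable {r : ℕ}

/-- The variables `x_i^{(c)}`, ordered by decreasing index and then by decreasing color. -/
abbrev Label (r : ℕ) : Type :=
  ℕᵒᵈ ×ₗ (Fin r)ᵒᵈ

/-- The label of the variable `x_i^{(c)}`. -/
def label (x : Fin r × ℕ) : Label r :=
  toLex (OrderDual.toDual x.2, OrderDual.toDual x.1)

theorem label_injective : Function.Injective (label (r := r)) := by
  rintro ⟨c, i⟩ ⟨c', i'⟩ h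
  obtain ⟨h1, h2⟩ := Prod.mk.inj (toLex_inj.1 h)
  rw [OrderDual.toDual_inj] at h1 h2
  exact Prod.ext h2 h1

theorem label_surjective : Function.Surjective (label (r := r)) := fun x =>
  ⟨(OrderDual.ofDual (ofLex x).2, OrderDual.ofDual (ofLex x).1), rfl⟩

theorem label_lt_label {c c' : Fin r} {i i' : ℕ} :
    label (c, i) < label (c', i') ↔ i' < i ∨ i = i' ∧ c' < c := by
  rw [label, label, Prod.Lex.toLex_lt_toLex]
  simp only [OrderDual.toDual_lt_toDual, OrderDual.toDual_inj]

end Labels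

/-! ### Absolute involutions and descents through labels -/

section Involutions

variable {n r : ℕ} [NeZero r]

/-- The underlying permutation of `w`. -/
def letter (w : coloredPerm n r) (k : Fin n) : Fin n :=
  (window w k).1

/-- The color vector of `w`. -/
def color (w : coloredPerm n r) (k : Fin n) : Fin r :=
  (window w k).2

theorem coloredPerm_apply (w : coloredPerm n r) (a : Fin n) (i : Fin r) :
    (w : Equiv.Perm (Fin n × Fin r)) (a, i) = (letter w a, i + color w a) :=
  w.2 a _ i _ rfl

theorem coloredPerm_ext {w w' : coloredPerm n r} (h1 : letter w = letter w')
    (h2 : color w = color w') : w = w' := by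
  apply Subtype.ext
  ext1 ⟨a, i⟩
  rw [coloredPerm_apply, coloredPerm_apply, h1, h2]

/-- The product `bar w * w` sends position `k` to `w(w(k))` with color `c_k - c_{w(k)}`, and it must
be the identity. The bar thus removes every restriction on the color of a cycle. -/
theorem mem_absInvolutions {w : coloredPerm n r} :
    w ∈ absInvolutions n r ↔
      Function.Involutive (letter w) ∧ ∀ k, color w (letter w k) = color w k := by
  have hbar : ∀ k, window (bar w * w) k =
      (letter w (letter w k), color w k + -color w (letter w k)) := by
    intro k
    change (bar w : Equiv.Perm (Fin n × Fin r)) ((w : Equiv.Perm (Fin n × Fin r)) (k, 0)) = _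
    rw [coloredPerm_apply, coloredPerm_apply, zero_add]
    simp only [letter, color, window_bar]
  rw [absInvolutions, Set.Finite.mem_toFinset]
  change (bar w)⁻¹ = w ↔ _
  rw [inv_eq_iff_mul_eq_one]
  constructor
  · intro h
    have h1 : ∀ k, window (bar w * w) k = (k, 0) := fun k => by rw [h]; rfl
    simp only [hbar, Prod.mk.injEq] at h1
    exact ⟨fun k => (h1 k).1, fun k => (add_neg_eq_zero.1 (h1 k).2).symm⟩
  · rintro ⟨h1, h2⟩
    apply coloredPerm_ext
    · funext k
      rw [letter, hbar, h1 k]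
      rfl
    · funext k
      rw [color, hbar, h2 k, add_neg_cancel]
      rfl

theorem exists_coloredPerm {u : Fin n → Fin n} (hu : Function.Involutive u) {col : Fin n → Fin r}
    (hcol : ∀ k, col (u k) = col k) :
    ∃ w ∈ absInvolutions n r, letter w = u ∧ color w = col := by
  let f : Equiv.Perm (Fin n × Fin r) :=
    { toFun := fun x => (u x.1, x.2 + col x.1)
      invFun := fun x => (u x.1, x.2 - col x.1)
      left_inv := fun x => by simp [hu x.1, hcol]
      right_inv := fun x => by simp [hu x.1, hcol] }
  have hf : f ∈ coloredPerm n r := by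
    intro a b i j h
    simp only [f, Equiv.coe_fn_mk, Prod.mk.injEq, zero_add] at h ⊢
    exact ⟨h.1, by rw [h.2]⟩
  have h1 : letter (⟨f, hf⟩ : coloredPerm n r) = u := rfl
  have h2 : color (⟨f, hf⟩ : coloredPerm n r) = col := by
    funext k
    change 0 + col k = col k
    rw [zero_add]
  refine ⟨⟨f, hf⟩, mem_absInvolutions.2 ?_, h1, h2⟩
  rw [h1, h2]
  exact ⟨hu, hcol⟩

/-- The labels of the positions of `w` given by an index sequence. -/
def positionLabel (w : coloredPerm n r) (s : Fin n → ℕ) (k : Fin n) : Label r :=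
  label (color w k, s k)

theorem strictMono_fin_iff {α : Type*} [Preorder α] {f : Fin n → α} :
    StrictMono f ↔ ∀ (k : ℕ) (h : k + 1 < n), f ⟨k, Nat.lt_of_succ_lt h⟩ < f ⟨k + 1, h⟩ := by
  cases n with
  | zero => exact ⟨fun _ k h => absurd h (Nat.not_lt_zero _), fun _ k => k.elim0⟩
  | succ n =>
    rw [Fin.strictMono_iff_lt_succ]
    exact ⟨fun h k hk => h ⟨k, Nat.lt_of_succ_lt_succ hk⟩, fun h i => h i (Nat.succ_lt_succ i.2)⟩

theorem antitone_fin_iff {α : Type*} [Preorder α] {f : Fin n → α} :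
    Antitone f ↔ ∀ (k : ℕ) (h : k + 1 < n), f ⟨k + 1, h⟩ ≤ f ⟨k, Nat.lt_of_succ_lt h⟩ := by
  cases n with
  | zero => exact ⟨fun _ k h => absurd h (Nat.not_lt_zero _), fun _ k => k.elim0⟩
  | succ n =>
    rw [Fin.antitone_iff_succ_le]
    exact ⟨fun h k hk => h ⟨k, Nat.lt_of_succ_lt_succ hk⟩, fun h i => h i (Nat.succ_lt_succ i.2)⟩

/-- Both conditions are local. At an equality of indices, lexicographic increase of color (reversed)
and letter says exactly that `k` is not a descent; injectivity excludes equal letters. -/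
theorem mem_fundamentalIndices_iff {w : coloredPerm n r} (hw : Function.Injective (letter w))
    {s : Fin n → ℕ} :
    s ∈ fundamentalIndices w ↔ StrictMono fun k => toLex (positionLabel w s k, letter w k) := by
  change Antitone s ∧ _ ↔ _
  rw [antitone_fin_iff, strictMono_fin_iff, ← forall₂_and]
  refine forall₂_congr fun k h => ?_
  have hne : letter w ⟨k, Nat.lt_of_succ_lt h⟩ ≠ letter w ⟨k + 1, h⟩ := fun h' => by
    simpa using hw h'
  have hd : IsDescent w k ↔ color w ⟨k, Nat.lt_of_succ_lt h⟩ < color w ⟨k + 1, h⟩ ∨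
      (color w ⟨k + 1, h⟩ = color w ⟨k, Nat.lt_of_succ_lt h⟩ ∧
        letter w ⟨k + 1, h⟩ < letter w ⟨k, Nat.lt_of_succ_lt h⟩) :=
    ⟨fun ⟨_, h'⟩ => h', fun h' => ⟨h, h'⟩⟩
  rw [hd, Prod.Lex.toLex_lt_toLex]
  simp only [positionLabel, label_lt_label, label_injective.eq_iff, Prod.mk.injEq]
  generalize color w ⟨k, Nat.lt_of_succ_lt h⟩ = c at *
  generalize color w ⟨k + 1, h⟩ = c' at *
  generalize letter w ⟨k, Nat.lt_of_succ_lt h⟩ = a at *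
  generalize letter w ⟨k + 1, h⟩ = a' at *
  generalize s ⟨k, Nat.lt_of_succ_lt h⟩ = i at *
  generalize s ⟨k + 1, h⟩ = i' at *
  simp only [Fin.lt_def, Fin.ext_iff, ne_eq] at *
  omega

end Involutions

/-! ### Weights of families of symmetric matrices -/

section Scalars

variable {r : ℕ} {R : Type*} [CommRing R]

/-- The scalars of the monomials `symExponent`. -/
def coloredScalar (p : Fin r → R) (x : Fin r × SymIndex) : R :=
  symScalar (p x.1) x.2

theorem scalarWeight_coloredScalar (p : Fin r → R) {A : Fin r × SymIndex →₀ ℕ} {N : ℕ}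
    (hA : ∀ c k, N ≤ k → A (c, Sum.inl k) = 0) :
    scalarWeight (coloredScalar p) A = ∏ c, p c ^ ∑ k ∈ Finset.range N, A (c, Sum.inl k) := by
  classical
  let T : Finset (Fin r × SymIndex) := Finset.univ ×ˢ (Finset.range N).image Sum.inl
  have himage : ∏ c, p c ^ ∑ k ∈ Finset.range N, A (c, Sum.inl k) =
      ∏ x ∈ T, coloredScalar p x ^ A x := by
    rw [Finset.prod_product]
    refine Finset.prod_congr rfl fun c _ => ?_
    rw [Finset.prod_image fun _ _ _ _ h => Sum.inl_injective h, ← Finset.prod_pow_eq_pow_sum]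
    rfl
  rw [himage, scalarWeight, Finsupp.prod_of_support_subset A (s := A.support ∪ T)
      Finset.subset_union_left _ (by simp)]
  symm
  refine Finset.prod_subset Finset.subset_union_right ?_
  rintro ⟨c, k | q⟩ _ h
  · rw [hA c k, pow_zero]
    by_contra! hk
    exact h (Finset.mem_product.2
      ⟨Finset.mem_univ _, Finset.mem_image.2 ⟨k, Finset.mem_range.2 hk, rfl⟩⟩)
  · simp [coloredScalar, symScalar]

end Scalars

/-! ### Indexed absolute involutions correspond to symmetric matrices -/

section InvolutionMatrices

variable {n r : ℕ} [NeZero r]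

/-- The symmetric matrices, one for each color, which count the pairs `k`, `w(k)` of positions by
their indices. -/
def involutionMatrix (w : coloredPerm n r) (s : Fin n → ℕ) : Fin r × SymIndex →₀ ℕ :=
  Finsupp.onFinset
    (Finset.univ.image fun k => (color w k, symIndex (s k) (s (letter w k))))
    (fun x => (Finset.univ.filter fun k =>
      -- The inequality keeps one position of a cycle whose two indices differ, so that an
      -- off-diagonal entry is not counted twice.
      s k ≤ s (letter w k) ∧ (color w k, symIndex (s k) (s (letter w k))) = x).card)
    (fun x hx => by
      obtain ⟨k, hk⟩ := Finset.card_pos.1 (Nat.pos_of_ne_zero hx)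
      exact Finset.mem_image.2 ⟨k, Finset.mem_univ k, (Finset.mem_filter.1 hk).2.2⟩)

theorem symIndex_eq_symIndex_of_le {i j i' j' : ℕ} (h : i ≤ j) (h' : i' ≤ j') :
    symIndex i j = symIndex i' j' ↔ i = i' ∧ j = j' := by
  rcases h'.lt_or_eq with h1 | rfl
  · rw [symIndex_of_lt h1, symIndex_eq_inr]
    simp only
    omega
  · rw [symIndex_self, symIndex_eq_inl]

theorem labelMatrix_comm {Λ : Type*} [LinearOrder Λ] {u : Fin n → Fin n}
    (hu : Function.Involutive u) (l : Fin n → Λ) (x y : Λ) :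
    labelMatrix u l x y = labelMatrix u l y x := by
  refine Finset.card_bij (fun k _ => u k) ?_ ?_ ?_
  · intro k hk
    simp only [Finset.mem_filter, Finset.mem_univ, true_and, hu k] at hk ⊢
    exact hk.symm
  · intro k _ k' _ h
    exact hu.injective h
  · intro k hk
    refine ⟨u k, ?_, hu k⟩
    simp only [Finset.mem_filter, Finset.mem_univ, true_and, hu k] at hk ⊢
    exact hk.symm

theorem involutionMatrix_apply {w : coloredPerm n r} (hw : w ∈ absInvolutions n r)
    (s : Fin n → ℕ) (c : Fin r) (i j : ℕ) :
    involutionMatrix w s (c, symIndex i j) =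
      labelMatrix (letter w) (positionLabel w s) (label (c, i)) (label (c, j)) := by
  rw [mem_absInvolutions] at hw
  have key : ∀ i j, i ≤ j → involutionMatrix w s (c, symIndex i j) =
      labelMatrix (letter w) (positionLabel w s) (label (c, i)) (label (c, j)) := by
    intro i j hij
    rw [involutionMatrix, Finsupp.onFinset_apply, labelMatrix]
    congr 1
    refine Finset.filter_congr fun k _ => ?_
    simp only [positionLabel, label_injective.eq_iff, Prod.mk.injEq, hw.2 k]
    constructor
    · rintro ⟨h1, h2, h3⟩
      rw [symIndex_eq_symIndex_of_le h1 hij] at h3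
      exact ⟨⟨h2, h3.1⟩, h2, h3.2⟩
    · rintro ⟨⟨h1, h2⟩, -, h3⟩
      rw [h2, h3]
      exact ⟨hij, h1, rfl⟩
  rcases le_total i j with h | h
  · exact key i j h
  · rw [symIndex_comm, key j i h, labelMatrix_comm hw.1]

theorem labelMatrix_eq_zero_of_color_ne {w : coloredPerm n r} (hw : w ∈ absInvolutions n r)
    (s : Fin n → ℕ) {c c' : Fin r} (hc : c ≠ c') (i j : ℕ) :
    labelMatrix (letter w) (positionLabel w s) (label (c, i)) (label (c', j)) = 0 := by
  rw [mem_absInvolutions] at hw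
  rw [labelMatrix, Finset.card_eq_zero, Finset.filter_eq_empty_iff]
  intro k _
  simp only [positionLabel, label_injective.eq_iff, Prod.mk.injEq, hw.2 k]
  rintro ⟨⟨h1, -⟩, h2, -⟩
  exact hc (h1.symm.trans h2)

theorem exists_index_bound (s : Fin n → ℕ) : ∃ N, ∀ k, s k < N :=
  ⟨Finset.univ.sup s + 1, fun k => Nat.lt_succ_iff.2 (Finset.le_sup (f := s) (Finset.mem_univ k))⟩

theorem involutionMatrix_eq_zero {w : coloredPerm n r} (hw : w ∈ absInvolutions n r)
    {s : Fin n → ℕ} {N : ℕ} (hN : ∀ k, s k < N) (c : Fin r) (i : ℕ) {j : ℕ} (hj : N ≤ j) :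
    involutionMatrix w s (c, symIndex i j) = 0 := by
  rw [involutionMatrix_apply hw, labelMatrix, Finset.card_eq_zero, Finset.filter_eq_empty_iff]
  intro k _
  simp only [positionLabel, label_injective.eq_iff, Prod.mk.injEq]
  rintro ⟨-, -, h⟩
  have := hN (letter w k)
  omega

/-- Row `i` of the matrix of color `c` sorts the positions of color `c` and index `i` by the index
of their image, so its sum counts all of them. -/
theorem totalExponent_involutionMatrix {w : coloredPerm n r} (hw : w ∈ absInvolutions n r)
    (s : Fin n → ℕ) :
    totalExponent symExponent (involutionMatrix w s) =
      ∑ k, Finsupp.single ((window w k).2, s k) 1 := by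
  classical
  obtain ⟨N, hN⟩ := exists_index_bound s
  have hw' := mem_absInvolutions.1 hw
  ext ⟨c, i⟩
  rw [totalExponent_symExponent_apply fun j => involutionMatrix_eq_zero hw hN c i,
    Finsupp.finsetSum_apply]
  have h1 : ∀ k, (Finsupp.single ((window w k).2, s k) 1 : Fin r × ℕ →₀ ℕ) (c, i) =
      if color w k = c ∧ s k = i then 1 else 0 := by
    intro k
    rw [Finsupp.single_apply]
    exact if_congr Prod.mk_inj rfl rfl
  rw [Finset.sum_congr rfl fun k _ => h1 k, ← Finset.card_filter,
    Finset.card_eq_sum_card_fiberwise (f := fun k => s (letter w k)) (t := Finset.range N)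
      (fun k _ => by simpa using hN _)]
  refine Finset.sum_congr rfl fun j _ => ?_
  rw [involutionMatrix_apply hw, labelMatrix, Finset.filter_filter]
  congr 1
  refine Finset.filter_congr fun k _ => ?_
  simp only [positionLabel, label_injective.eq_iff, Prod.mk.injEq, hw'.2 k]
  tauto

theorem labeledInvolution_iff {w : coloredPerm n r} (hw : w ∈ absInvolutions n r)
    {s : Fin n → ℕ} :
    s ∈ fundamentalIndices w ↔ LabeledInvolution (letter w) (positionLabel w s) := by
  have hw' := mem_absInvolutions.1 hw
  rw [mem_fundamentalIndices_iff hw'.1.injective]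
  exact ⟨fun h => ⟨hw'.1, h⟩, fun h => h.2⟩

/-- Compatibility of `s` is essential: it ensures that a position sharing its label with its image
is fixed. -/
theorem sum_involutionMatrix_inl {w : coloredPerm n r} (hw : w ∈ absInvolutions n r)
    {s : Fin n → ℕ} (hs : s ∈ fundamentalIndices w) {N : ℕ} (hN : ∀ k, s k < N) (c : Fin r) :
    ∑ i ∈ Finset.range N, involutionMatrix w s (c, Sum.inl i) = fixCount w c := by
  classical
  have hw' := mem_absInvolutions.1 hw
  rw [labeledInvolution_iff hw] at hs
  rw [fixCount, Finset.card_eq_sum_card_fiberwise (f := s) (t := Finset.range N)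
    (fun k _ => by simpa using hN k)]
  refine Finset.sum_congr rfl fun i _ => ?_
  rw [← symIndex_self, involutionMatrix_apply hw, labelMatrix, Finset.filter_filter]
  congr 1
  refine Finset.filter_congr fun k _ => ?_
  constructor
  · rintro ⟨h1, h2⟩
    have h3 := hs.fixed_of_label_eq (h1.trans h2.symm)
    simp only [positionLabel, label_injective.eq_iff, Prod.mk.injEq] at h1
    exact ⟨Prod.ext h3 h1.1, h1.2⟩
  · rintro ⟨h1, h2⟩
    have h3 : letter w k = k := congrArg Prod.fst h1
    have h4 : color w k = c := congrArg Prod.snd h1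
    rw [h3]
    simp [positionLabel, h2, h4]

variable {R : Type*} [CommRing R]

theorem scalarWeight_involutionMatrix (p : Fin r → R) {w : coloredPerm n r}
    (hw : w ∈ absInvolutions n r) {s : Fin n → ℕ} (hs : s ∈ fundamentalIndices w) :
    scalarWeight (coloredScalar p) (involutionMatrix w s) = ∏ c, p c ^ fixCount w c := by
  obtain ⟨N, hN⟩ := exists_index_bound s
  rw [scalarWeight_coloredScalar p (N := N)]
  · simp only [sum_involutionMatrix_inl hw hs hN]
  · intro c k hk
    rw [← symIndex_self, involutionMatrix_eq_zero hw hN c k hk]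

theorem involutionMatrix_injective {w w' : coloredPerm n r} (hw : w ∈ absInvolutions n r)
    (hw' : w' ∈ absInvolutions n r) {s s' : Fin n → ℕ} (hs : s ∈ fundamentalIndices w)
    (hs' : s' ∈ fundamentalIndices w') (h : involutionMatrix w s = involutionMatrix w' s') :
    w = w' ∧ s = s' := by
  have hM : ∀ x y, labelMatrix (letter w) (positionLabel w s) x y =
      labelMatrix (letter w') (positionLabel w' s') x y := by
    intro x y
    obtain ⟨⟨c, i⟩, rfl⟩ := label_surjective x
    obtain ⟨⟨c', j⟩, rfl⟩ := label_surjective y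
    by_cases hc : c = c'
    · subst hc
      rw [← involutionMatrix_apply hw, ← involutionMatrix_apply hw', h]
    · rw [labelMatrix_eq_zero_of_color_ne hw s hc, labelMatrix_eq_zero_of_color_ne hw' s' hc]
  obtain ⟨h1, h2⟩ := ((labeledInvolution_iff hw).1 hs).eq_of_labelMatrix_eq
    ((labeledInvolution_iff hw').1 hs') hM
  have h3 : ∀ k, color w k = color w' k ∧ s k = s' k := fun k =>
    Prod.mk.inj (label_injective (congrFun h2 k))
  exact ⟨coloredPerm_ext h1 (funext fun k => (h3 k).1), funext fun k => (h3 k).2⟩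

theorem exists_involutionMatrix_eq (A : Fin r × SymIndex →₀ ℕ) :
    ∃ (n : ℕ) (w : coloredPerm n r) (s : Fin n → ℕ), w ∈ absInvolutions n r ∧
      s ∈ fundamentalIndices w ∧ involutionMatrix w s = A := by
  classical
  obtain ⟨g, hg⟩ := label_surjective (r := r).hasRightInverse
  have hgl : ∀ x, g (label x) = x := fun x => label_injective (hg (label x))
  -- One symmetric matrix on all labels, block diagonal by color; the zero blocks later force colors
  -- to be constant on cycles.
  let B : Label r → Label r → ℕ := fun x y =>
    if (g x).1 = (g y).1 then A ((g x).1, symIndex (g x).2 (g y).2) else 0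
  obtain ⟨n, u, l, hul, hB⟩ := exists_labeledInvolution (B := B)
    (fun x y => by
      by_cases h : (g x).1 = (g y).1
      · simp only [B, h, if_true]
        rw [symIndex_comm]
      · simp only [B, h, Ne.symm h, if_false])
    ((totalExponent symExponent A).support.image label)
    (fun x y hxy => by
      have h : (g x).1 = (g y).1 := by
        by_contra h
        exact hxy (if_neg h)
      simp only [B, h, if_true] at hxy
      refine Finset.mem_image.2 ⟨g x, ?_, hg x⟩
      rw [Finsupp.mem_support_iff]
      have := apply_symIndex_le A (g x).1 (g x).2 (g y).2
      rw [h] at this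
      rw [← Prod.mk.eta (p := g x), h]
      omega)
  have hcol : ∀ k, (g (l (u k))).1 = (g (l k)).1 := by
    intro k
    have h0 : labelMatrix u l (l k) (l (u k)) ≠ 0 :=
      (Finset.card_pos.2 ⟨k, by simp⟩).ne'
    rw [hB] at h0
    by_contra h
    exact h0 (if_neg (Ne.symm h))
  obtain ⟨w, hw, hwu, hwc⟩ := exists_coloredPerm (r := r) (col := fun k => (g (l k)).1) hul.1 hcol
  have hlab : positionLabel w (fun k => (g (l k)).2) = l := by
    funext k
    rw [positionLabel, hwc]
    exact hg (l k)
  refine ⟨n, w, fun k => (g (l k)).2, hw, ?_, ?_⟩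
  · rw [labeledInvolution_iff hw, hlab, hwu]
    exact hul
  · ext ⟨c, t⟩
    obtain ⟨i, j, -, rfl⟩ := exists_symIndex_eq t
    rw [involutionMatrix_apply hw, hlab, hwu, hB]
    simp only [B, hgl, if_true]

/-- The absolute involutions with a compatible index sequence of given content. -/
def indexedInvolutions (n : ℕ) (m : Fin r × ℕ →₀ ℕ) : Set (coloredPerm n r × (Fin n → ℕ)) :=
  {x | x.1 ∈ absInvolutions n r ∧ x.2 ∈ fundamentalIndices x.1 ∧
    ∑ k, Finsupp.single ((window x.1 k).2, x.2 k) 1 = m}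

theorem degree_content (w : coloredPerm n r) (s : Fin n → ℕ) :
    (∑ k, Finsupp.single ((window w k).2, s k) 1 : Fin r × ℕ →₀ ℕ).degree = n := by
  rw [map_sum]
  simp [Finsupp.degree_single]

theorem bijOn_involutionMatrix {m : Fin r × ℕ →₀ ℕ} (hm : m.degree = n) :
    Set.BijOn (fun x : coloredPerm n r × (Fin n → ℕ) => involutionMatrix x.1 x.2)
      (indexedInvolutions n m) (multiplicities symExponent Set.univ m) := by
  refine ⟨?_, ?_, ?_⟩
  · rintro x ⟨h1, h2, h3⟩
    exact ⟨Set.subset_univ _, by rw [totalExponent_involutionMatrix h1, h3]⟩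
  · rintro ⟨w, s⟩ ⟨h1, h2, -⟩ ⟨w', s'⟩ ⟨h1', h2', -⟩ h
    obtain ⟨rfl, rfl⟩ := involutionMatrix_injective h1 h1' h2 h2' h
    rfl
  · rintro A ⟨-, hA⟩
    obtain ⟨n', w, s, hw, hs, rfl⟩ := exists_involutionMatrix_eq A
    rw [totalExponent_involutionMatrix hw] at hA
    -- The number of positions produced from the matrix is the degree of the content.
    obtain rfl : n' = n := by rw [← hm, ← hA, degree_content]
    exact ⟨(w, s), ⟨hw, hs, hA⟩, rfl⟩

theorem mk_absInvolutionSeries (p : Fin r → R) :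
    PowerSeries.mk (fun n => absInvolutionSeries n p) =
      multiplicitySeries symExponent (coloredScalar p) Set.univ := by
  classical
  ext n m
  rw [PowerSeries.coeff_mk, coeff_multiplicitySeries, absInvolutionSeries, map_sum]
  simp only [map_smul, smul_eq_mul]
  have hcoeff : ∀ w : coloredPerm n r, MvPowerSeries.coeff m (fundamental R w) =
      ({s : Fin n → ℕ | s ∈ fundamentalIndices w ∧
        ∑ k, Finsupp.single ((window w k).2, s k) 1 = m}.ncard : R) := fun w => rfl
  simp only [hcoeff]
  by_cases hn : m.degree = n
  · rw [if_pos hn]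
    have hbij := bijOn_involutionMatrix hn
    have hfin : (indexedInvolutions n m).Finite :=
      (symExponent_locallyFinite.finite_multiplicities _ _).of_injOn hbij.mapsTo hbij.injOn
    have hsum : ∑ᶠ x ∈ indexedInvolutions n m, ∏ c, p c ^ fixCount x.1 c =
        ∑ᶠ A ∈ multiplicities symExponent Set.univ m, scalarWeight (coloredScalar p) A :=
      finsum_mem_eq_of_bijOn _ hbij
        fun x hx => (scalarWeight_involutionMatrix p hx.1 hx.2.1).symm
    rw [← hsum, finsum_mem_eq_finite_toFinset_sum _ hfin,
      ← Finset.sum_fiberwise_of_maps_to (g := Prod.fst) (t := absInvolutions n r)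
        (fun x hx => ((Set.Finite.mem_toFinset hfin).1 hx).1)]
    refine Finset.sum_congr rfl fun w hw => ?_
    have hconst : ∀ x ∈ hfin.toFinset.filter (fun x => x.1 = w),
        ∏ c, p c ^ fixCount x.1 c = ∏ c, p c ^ fixCount w c := by
      intro x hx
      rw [(Finset.mem_filter.1 hx).2]
    rw [Finset.sum_congr rfl hconst, Finset.sum_const, nsmul_eq_mul, mul_comm,
      ← Set.ncard_coe_finset]
    congr 2
    refine Set.ncard_congr (fun s _ => (w, s)) ?_ ?_ ?_
    · intro s hs
      simp only [Finset.coe_filter, Set.Finite.mem_toFinset, Set.mem_ofPred_eq, and_true]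
      exact ⟨hw, hs.1, hs.2⟩
    · intro s s' _ _ h
      exact (Prod.mk.inj h).2
    · rintro ⟨w', s⟩ h
      simp only [Finset.coe_filter, Set.Finite.mem_toFinset, Set.mem_ofPred_eq] at h
      obtain ⟨⟨-, h1, h2⟩, rfl⟩ := h
      exact ⟨s, ⟨h1, h2⟩, rfl⟩
  · rw [if_neg hn]
    refine Finset.sum_eq_zero fun w _ => ?_
    rw [Set.eq_empty_of_forall_notMem (s := {s : Fin n → ℕ | s ∈ fundamentalIndices w ∧
        ∑ k, Finsupp.single ((window w k).2, s k) 1 = m}), Set.ncard_empty, Nat.cast_zero, mul_zero]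
    rintro s ⟨-, hs⟩
    exact hn (by rw [← hs, degree_content])

end InvolutionMatrices

/-! ### Regrouping the products by color and by kind of factor -/

section Products

variable {R : Type*} [CommRing R] {r : ℕ}

theorem LocallyFiniteMonomials.comp {ι κ σ : Type*} {e : ι → σ →₀ ℕ}
    (he : LocallyFiniteMonomials e) {f : κ → ι} (hf : Function.Injective f) :
    LocallyFiniteMonomials (e ∘ f) where
  ne_zero i := he.ne_zero (f i)
  finite_le m := (he.finite_le m).preimage hf.injOn

theorem fixFactor_eq (p : Fin r → R) (c : Fin r) (i : ℕ) :
    fixFactor p c i =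
      Ring.inverse (1 - gradedTerm (colorExponent c) (symScalar (p c)) (Sum.inl i)) := by
  have h : p c • (MvPowerSeries.X (c, i) : MvPowerSeries (Fin r × ℕ) R) =
      MvPowerSeries.monomial (Finsupp.single (c, i) 1) (p c) := by
    rw [MvPowerSeries.X, ← map_smul, smul_eq_mul, mul_one]
  rw [fixFactor, h]
  simp [gradedTerm, colorExponent, symExponent, symScalar, Finsupp.degree_single]

theorem pairFactor_eq (p : R) (c : Fin r) (q : {q : ℕ × ℕ // q.1 < q.2}) :
    pairFactor R c q.1.1 q.1.2 =
      Ring.inverse (1 - gradedTerm (colorExponent c) (symScalar p) (Sum.inr q)) := by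
  have h : (MvPowerSeries.X (c, q.1.1) * MvPowerSeries.X (c, q.1.2) :
      MvPowerSeries (Fin r × ℕ) R) = MvPowerSeries.monomial
        (Finsupp.single (c, q.1.1) 1 + Finsupp.single (c, q.1.2) 1) 1 := by
    rw [MvPowerSeries.X, MvPowerSeries.X, MvPowerSeries.monomial_mul_monomial, mul_one]
  rw [pairFactor, h]
  simp [gradedTerm, colorExponent, symExponent, symScalar, Finsupp.degree_single]

variable [TopologicalSpace R]

theorem multipliable_fixFactor (p : Fin r → R) (c : Fin r) :
    Multipliable fun i => fixFactor p c i := by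
  simp only [fixFactor_eq]
  exact (hasProd_inverse_one_sub ((colorExponent_locallyFinite c).comp Sum.inl_injective)
    (symScalar (p c) ∘ Sum.inl)).multipliable

theorem multipliable_pairFactor (c : Fin r) :
    Multipliable fun q : {q : ℕ × ℕ // q.1 < q.2} => pairFactor R c q.1.1 q.1.2 := by
  simp only [pairFactor_eq (1 : R)]
  exact (hasProd_inverse_one_sub ((colorExponent_locallyFinite c).comp Sum.inr_injective)
    (symScalar (1 : R) ∘ Sum.inr)).multipliable

variable [DiscreteTopology R]

theorem tprod_fixFactor_mul_tprod_pairFactor (p : Fin r → R) (c : Fin r) :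
    (∏' i : ℕ, fixFactor p c i) *
        ∏' q : {q : ℕ × ℕ // q.1 < q.2}, pairFactor R c q.1.1 q.1.2 =
      multiplicitySeries (colorExponent c) (symScalar (p c)) Set.univ := by
  have h1 := (multipliable_fixFactor p c).hasProd
  have h2 := (multipliable_pairFactor (R := R) c).hasProd
  refine HasProd.unique (HasProd.sum (f := fun t =>
    Ring.inverse (1 - gradedTerm (colorExponent c) (symScalar (p c)) t)) ?_ ?_)
    (hasProd_inverse_one_sub (colorExponent_locallyFinite c) _)
  · convert h1 using 1
    funext i
    exact (fixFactor_eq p c i).symm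
  · convert h2 using 1
    funext q
    exact (pairFactor_eq (p c) c q).symm

/-- Both sides are values of the same infinite product, taken at once or color by color; uniqueness
of limits identifies them. -/
theorem multiplicitySeries_symExponent (p : Fin r → R) :
    multiplicitySeries symExponent (coloredScalar p) Set.univ =
      ∏ c, multiplicitySeries (colorExponent c) (symScalar (p c)) Set.univ := by
  have h1 := hasProd_inverse_one_sub (symExponent_locallyFinite (r := r)) (coloredScalar p)
  have h2 := h1.prod_fiberwise fun c =>
    hasProd_inverse_one_sub (colorExponent_locallyFinite c) (symScalar (p c))
  exact h2.unique (hasProd_fintype _)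

/-- Expanding the product gives tuples of diagrams grouped by their vectors of sizes, and these
vectors run over the ways of writing `n` as an ordered sum. -/
theorem prod_mk_sum_diagrams {S : Type*} [CommRing S] {r : ℕ} (f : Fin r → YoungDiagram → S)
    (n : ℕ) :
    PowerSeries.coeff n (∏ c, PowerSeries.mk fun k => ∑ μ ∈ diagrams k, f c μ) =
      ∑ l ∈ rPartitePartitions r n, ∏ c, f c (l c) := by
  classical
  have hmem : ∀ l : Fin r → YoungDiagram,
      l ∈ rPartitePartitions r n ↔ ∑ j, (l j).card = n := fun l => by
    rw [rPartitePartitions, Set.Finite.mem_toFinset]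
    rfl
  rw [PowerSeries.coeff_prod]
  simp only [PowerSeries.coeff_mk, Finset.prod_univ_sum]
  rw [← Finset.sum_fiberwise_of_maps_to
    (g := fun l : Fin r → YoungDiagram => Finsupp.equivFunOnFinite.symm fun j => (l j).card)
    (t := Finset.univ.finsuppAntidiag n)]
  · refine Finset.sum_congr rfl fun d hd => Finset.sum_congr ?_ fun _ _ => rfl
    have hd' : ∑ j, d j = n := by simpa using hd
    ext l
    rw [Fintype.mem_piFinset, Finset.mem_filter, hmem]
    simp only [mem_diagrams, Equiv.symm_apply_eq, funext_iff, Finsupp.equivFunOnFinite_apply]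
    exact ⟨fun h => ⟨by simp only [h, hd'], h⟩, fun h => h.2⟩
  · intro l hl
    rw [hmem] at hl
    simpa using hl

end Products

end ColoredQSym

end

theorem theorem4p8 {R : Type*} [CommRing R] [TopologicalSpace R] [DiscreteTopology R]
    (r : ℕ) [NeZero r] (p : Fin r → R) :
    ((∀ c : Fin r, Multipliable fun i : ℕ => ColoredQSym.fixFactor p c i) ∧
      (∀ c : Fin r, Multipliable fun q : {q : ℕ × ℕ // q.1 < q.2} =>
        ColoredQSym.pairFactor R c q.1.1 q.1.2) ∧
      PowerSeries.mk (fun n => ColoredQSym.absInvolutionSeries n p) =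
        ∏ c : Fin r, ((∏' i : ℕ, ColoredQSym.fixFactor p c i) *
          ∏' q : {q : ℕ × ℕ // q.1 < q.2}, ColoredQSym.pairFactor R c q.1.1 q.1.2)) ∧
    ∀ n : ℕ, ColoredQSym.absInvolutionSeries n p =
      ∑ l ∈ ColoredQSym.rPartitePartitions r n,
        ∏ j : Fin r, p j ^ ColoredQSym.oddColumns (l j) • ColoredQSym.schur R j (l j) := by
  -- The product of the one-color matrix series is the common value: each factor is an infinite
  -- product on one hand and a Littlewood sum on the other.
  have hmk : PowerSeries.mk (fun n => ColoredQSym.absInvolutionSeries n p) =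
      ∏ c, ColoredQSym.multiplicitySeries (ColoredQSym.colorExponent c)
        (ColoredQSym.symScalar (p c)) Set.univ := by
    rw [ColoredQSym.mk_absInvolutionSeries, ColoredQSym.multiplicitySeries_symExponent]
  refine ⟨⟨ColoredQSym.multipliable_fixFactor p, ColoredQSym.multipliable_pairFactor, ?_⟩,
    fun n => ?_⟩
  · simp only [ColoredQSym.tprod_fixFactor_mul_tprod_pairFactor, hmk]
  · rw [← PowerSeries.coeff_mk n (fun n => ColoredQSym.absInvolutionSeries n p), hmk]
    simp only [← ColoredQSym.mk_sum_schur]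
    rw [ColoredQSym.prod_mk_sum_diagrams]
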